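/- Let $N\ge 1$, let $\lambda_1,\dots,\lambda_N$ be distinct nonzero numbers, $\Lambda=\mathrm{diag}(\lambda_1,\dots,\lambda_N)$, and $\langle a,b\rangle=\sum_j a_jb_j$. On the phase space of points $(q,p)$, with canonical Poisson bracket $\{f,g\}=\langle \partial f/\partial q,\partial g/\partial p\rangle-\langle \partial f/\partial p,\partial g/\partial q\rangle$, put $$F=\langle q,q\rangle-\langle p,p\rangle-\tfrac14,\qquad G=\tfrac12\left(\langle\Lambda q,q\rangle+\langle\Lambda p,p\rangle\right),$$ $$\mathbb M=\{(q,p): F=0,\ G=0,\ \langle\Lambda q,p\rangle\neq0\},$$ $$\{f,g\}_D=\{f,g\}+\frac{1}{4\langle\Lambda q,p\rangle}\left(\{f,F\}\{G,g\}-\{f,G\}\{F,g\}\right),$$ and for $m=-1,-2,\dots$ $$F_m=\tfrac18\left(\langle\Lambda^{2m}p,p\rangle-\langle\Lambda^{2m}q,q\rangle\right)+\tfrac14\sum_{j=m}^{-2}\left(\langle\Lambda^{2(j+1)}q,q\rangle-\langle\Lambda^{2(j+1)}p,p\rangle\right)\left(\langle\Lambda^{2(m-j-1)}p,p\rangle-\langle\Lambda^{2(m-j-1)}q,q\rangle\right)$$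 $$\qquad+\tfrac14\sum_{j=m}^{-1}\begin{vmatrix}\langle\Lambda^{2j+1}q,q\rangle+\langle\Lambda^{2j+1}p,p\rangle&2\langle\Lambda^{2(m-j)-1}p,q\rangle\\2\langle\Lambda^{2j+1}q,p\rangle&\langle\Lambda^{2(m-j)-1}q,q\rangle+\langle\Lambda^{2(m-j)-1}p,p\rangle\end{vmatrix}.$$ Call a vector field on $\mathbb M$ Liouville completely integrable, with Hamiltonian $h$ and integrals $f_1,\dots,f_{N-1}$, if it is tangent to $\mathbb M$ and equals $(\{q,h\}_D,\{p,h\}_D)$ on $\mathbb M$, if $h$ and the $f_i$ are smooth, if $\{h,f_i\}_D=\{f_i,f_k\}_D=0$ on $\mathbb M$ for all $i,k$, and if the differentials of the $f_i$ restricted to the tangent spaces of $\mathbb M$ are linearly independent on a dense open subset of $\mathbb M$. (a) Let $\lambda_j\in\mathbb C$ and let the phase space be $\mathbb C^{2N}$ (all derivatives being complex). Then $\mathbb M$ is a symplectic submanifold: at each of its points $dF,dG$ are linearly independent and the symplectic form is nondegenerate on the tangent space. With $H=-i\langle\Lambda q,p\rangle$ one has $\{F_m,F_n\}_D=\{H,F_m\}_D=0$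 on $\mathbb M$ for all $m,n\le-1$. The restricted MKdV flow $$q_x=-i\Lambda q+up,\qquad p_x=uq+i\Lambda p,\qquad u=i\,\frac{\langle\Lambda^2q,q\rangle-\langle\Lambda^2p,p\rangle}{2\langle\Lambda q,p\rangle}$$ on $\mathbb M$ is Liouville completely integrable with Hamiltonian $H$ and integrals $F_{-1},\dots,F_{-(N-1)}$. For every $m\le-1$ the flow $(F_m)_D$: $q_{t_m}=\{q,F_m\}_D$, $p_{t_m}=\{p,F_m\}_D$ on $\mathbb M$ is Liouville completely integrable with Hamiltonian $F_m$ and the same integrals. (b) If the $\lambda_j$ are real, the same holds on the real phase space $\mathbb R^{2N}$, where $H$ is replaced by $iH=\langle\Lambda q,p\rangle$ and the restricted MKdV flow by $i$ times its vector field (that is, by the flow in the variable $s$ with $x=is$), which is real: $q_s=\Lambda q-vp$, $p_s=-vq-\Lambda p$ with $u=iv$. -/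

import Mathlib

open scoped Matrix ContDiff

namespace RestrictedMKdV

/-- The phase space of points `(q, p)` with `q, p ∈ 𝕜ᴺ`, for `𝕜 = ℝ` or `𝕜 = ℂ`. -/
abbrev Phase (𝕜 : Type*) (N : ℕ) : Type _ := (Fin N → 𝕜) × (Fin N → 𝕜)

section
variable {𝕜 : Type*} [NontriviallyNormedField 𝕜] {N : ℕ}

/-- `Λᵏ a`, where `Λ = diag(λ₁, …, λ_N)` and `k` is an integer. The pairing `⟨a, b⟩ = ∑ a_j b_j` is
Mathlib's `a ⬝ᵥ b` (bilinear, also over `ℂ`). -/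
def Lam (lam : Fin N → 𝕜) (k : ℤ) (a : Fin N → 𝕜) : Fin N → 𝕜 := fun j => lam j ^ k * a j

/-- `∂f/∂q_j` at `z`. -/
noncomputable def dq (f : Phase 𝕜 N → 𝕜) (z : Phase 𝕜 N) (j : Fin N) : 𝕜 :=
  fderiv 𝕜 f z (Pi.single j 1, 0)

/-- `∂f/∂p_j` at `z`. -/
noncomputable def dp (f : Phase 𝕜 N → 𝕜) (z : Phase 𝕜 N) (j : Fin N) : 𝕜 :=
  fderiv 𝕜 f z (0, Pi.single j 1)

/-- The canonical Poisson bracket `{f, g} = ⟨∂f/∂q, ∂g/∂p⟩ - ⟨∂f/∂p, ∂g/∂q⟩`. -/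
noncomputable def poisson (f g : Phase 𝕜 N → 𝕜) (z : Phase 𝕜 N) : 𝕜 :=
  dq f z ⬝ᵥ dp g z - dp f z ⬝ᵥ dq g z

/-- The canonical symplectic form. -/
def omega (v w : Phase 𝕜 N) : 𝕜 := v.1 ⬝ᵥ w.2 - v.2 ⬝ᵥ w.1

/-- The first constraint function, `F = ⟨q, q⟩ - ⟨p, p⟩ - 1/4`. -/
noncomputable def conF (z : Phase 𝕜 N) : 𝕜 := z.1 ⬝ᵥ z.1 - z.2 ⬝ᵥ z.2 - 1 / 4

/-- The second constraint function, `G = (⟨Λq, q⟩ + ⟨Λp, p⟩) / 2`. -/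
noncomputable def conG (lam : Fin N → 𝕜) (z : Phase 𝕜 N) : 𝕜 :=
  (Lam lam 1 z.1 ⬝ᵥ z.1 + Lam lam 1 z.2 ⬝ᵥ z.2) / 2

/-- The submanifold `M = {F = 0, G = 0}`, with the standing assumption `⟨Λq, p⟩ ≠ 0`. -/
def M (lam : Fin N → 𝕜) : Set (Phase 𝕜 N) :=
  {z | conF z = 0 ∧ conG lam z = 0 ∧ Lam lam 1 z.1 ⬝ᵥ z.2 ≠ 0}

/-- `T_z M`, as the common kernel of the differentials of the two constraints. -/
noncomputable def tangentM (lam : Fin N → 𝕜) (z : Phase 𝕜 N) : Submodule 𝕜 (Phase 𝕜 N) :=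
  LinearMap.ker (fderiv 𝕜 (conF (𝕜 := 𝕜) (N := N)) z).toLinearMap ⊓
    LinearMap.ker (fderiv 𝕜 (conG lam) z).toLinearMap

/-- `M` is a symplectic submanifold: the differentials of the two constraints are linearly
independent at each point of `M`, and the symplectic form is nondegenerate on each tangent space. -/
def IsSymplecticM (lam : Fin N → 𝕜) : Prop :=
  ∀ z ∈ M lam,
    LinearIndependent 𝕜 ![fderiv 𝕜 (conF (𝕜 := 𝕜) (N := N)) z, fderiv 𝕜 (conG lam) z] ∧
    ∀ v ∈ tangentM lam z, (∀ w ∈ tangentM lam z, omega v w = 0) → v = 0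

/-- The Dirac bracket of the constraint pair `(F, G)`; here `{F, G} = 4⟨Λq, p⟩`. -/
noncomputable def dirac (lam : Fin N → 𝕜) (f g : Phase 𝕜 N → 𝕜) (z : Phase 𝕜 N) : 𝕜 :=
  poisson f g z + 1 / (4 * (Lam lam 1 z.1 ⬝ᵥ z.2)) *
    (poisson f conF z * poisson (conG lam) g z - poisson f (conG lam) z * poisson conF g z)

/-- The vector field of `(h)_D`: `q' = {q, h}_D`, `p' = {p, h}_D`. -/
noncomputable def diracField (lam : Fin N → 𝕜) (h : Phase 𝕜 N → 𝕜) (z : Phase 𝕜 N) : Phase 𝕜 N :=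
  (fun j => dirac lam (fun w => w.1 j) h z, fun j => dirac lam (fun w => w.2 j) h z)

/-- The functions `F_m`, for `m = -1, -2, …`. -/
noncomputable def Fm (lam : Fin N → 𝕜) (m : ℤ) (z : Phase 𝕜 N) : 𝕜 :=
  let q := z.1
  let p := z.2
  1 / 8 * (Lam lam (2 * m) p ⬝ᵥ p - Lam lam (2 * m) q ⬝ᵥ q)
  + 1 / 4 * ∑ j ∈ Finset.Icc m (-2),
      (Lam lam (2 * (j + 1)) q ⬝ᵥ q - Lam lam (2 * (j + 1)) p ⬝ᵥ p) *
      (Lam lam (2 * (m - j - 1)) p ⬝ᵥ p - Lam lam (2 * (m - j - 1)) q ⬝ᵥ q)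
  + 1 / 4 * ∑ j ∈ Finset.Icc m (-1),
      Matrix.det
        !![Lam lam (2 * j + 1) q ⬝ᵥ q + Lam lam (2 * j + 1) p ⬝ᵥ p,
           2 * (Lam lam (2 * (m - j) - 1) p ⬝ᵥ q);
           2 * (Lam lam (2 * j + 1) q ⬝ᵥ p),
           Lam lam (2 * (m - j) - 1) q ⬝ᵥ q + Lam lam (2 * (m - j) - 1) p ⬝ᵥ p]

/-- The `N - 1` functions `F_{-1}, …, F_{-(N-1)}` (note that `dim M = 2(N - 1)`). -/
noncomputable def integrals (lam : Fin N → 𝕜) (i : Fin (N - 1)) : Phase 𝕜 N → 𝕜 :=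
  Fm lam (-((i : ℕ) + 1 : ℤ))

/-- The vector field `V` on `M` is Liouville completely integrable with respect to the Dirac bracket,
with Hamiltonian `h` and with the `N - 1 = dim M / 2` first integrals `f i`: `V` is tangent to `M` and
is the Hamiltonian vector field of `h`; the `f i` are constants of the motion, pairwise in involution,
and their differentials restricted to the tangent spaces of `M` are linearly independent on a dense
open subset of `M`. -/
structure IsLiouvilleIntegrable (lam : Fin N → 𝕜) (V : Phase 𝕜 N → Phase 𝕜 N)
    (h : Phase 𝕜 N → 𝕜) (f : Fin (N - 1) → Phase 𝕜 N → 𝕜) : Prop where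
  smooth_h : ∀ z ∈ M lam, ContDiffAt 𝕜 ∞ h z
  smooth_f : ∀ i, ∀ z ∈ M lam, ContDiffAt 𝕜 ∞ (f i) z
  tangent : ∀ z ∈ M lam, V z ∈ tangentM lam z
  hamiltonian : ∀ z ∈ M lam, V z = diracField lam h z
  conserved : ∀ i, ∀ z ∈ M lam, dirac lam h (f i) z = 0
  involution : ∀ i k, ∀ z ∈ M lam, dirac lam (f i) (f k) z = 0
  isOpen_independent : IsOpen {z : M lam | LinearIndependent 𝕜 fun i =>
    (fderiv 𝕜 (f i) (z : Phase 𝕜 N)).toLinearMap.domRestrict (tangentM lam (z : Phase 𝕜 N))}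
  dense_independent : Dense {z : M lam | LinearIndependent 𝕜 fun i =>
    (fderiv 𝕜 (f i) (z : Phase 𝕜 N)).toLinearMap.domRestrict (tangentM lam (z : Phase 𝕜 N))}

/-- `v = (⟨Λ²q, q⟩ - ⟨Λ²p, p⟩) / (2⟨Λq, p⟩)`; the MKdV potential is `u = i v`. -/
noncomputable def potential (lam : Fin N → 𝕜) (z : Phase 𝕜 N) : 𝕜 :=
  (Lam lam 2 z.1 ⬝ᵥ z.1 - Lam lam 2 z.2 ⬝ᵥ z.2) / (2 * (Lam lam 1 z.1 ⬝ᵥ z.2))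

/-- The function `i H = ⟨Λq, p⟩`. -/
def realH (lam : Fin N → 𝕜) (z : Phase 𝕜 N) : 𝕜 := Lam lam 1 z.1 ⬝ᵥ z.2

/-- The vector field `q' = Λq - v p`, `p' = -v q - Λp`: the restricted MKdV flow in the variable `s`
with `x = i s`. -/
noncomputable def realField (lam : Fin N → 𝕜) (z : Phase 𝕜 N) : Phase 𝕜 N :=
  (Lam lam 1 z.1 - potential lam z • z.2, -(potential lam z • z.1) - Lam lam 1 z.2)

end

section
variable {N : ℕ}

/-- `H = -i⟨Λq, p⟩`. -/
noncomputable def H (lam : Fin N → ℂ) (z : Phase ℂ N) : ℂ :=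
  -Complex.I * (Lam lam 1 z.1 ⬝ᵥ z.2)

/-- The vector field of the restricted MKdV flow: `q_x = -iΛq + u p`, `p_x = u q + iΛp`,
with `u = i (⟨Λ²q, q⟩ - ⟨Λ²p, p⟩) / (2⟨Λq, p⟩)`. -/
noncomputable def mkdvField (lam : Fin N → ℂ) (z : Phase ℂ N) : Phase ℂ N :=
  let u := Complex.I * potential lam z
  (-Complex.I • Lam lam 1 z.1 + u • z.2, u • z.1 + Complex.I • Lam lam 1 z.2)

/-- The inclusion of the real phase space in the complex one. -/
def toComplex (z : Phase ℝ N) : Phase ℂ N := (fun j => (z.1 j : ℂ), fun j => (z.2 j : ℂ))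

end

end RestrictedMKdV

open RestrictedMKdV

/-!
Write `a = q - p`, `b = q + p`. The functions `F_{-n}` are the Taylor coefficients at `μ = 0` of
`(μ u w - d²) / 4`, where `u = ∑ λ_j a_j² / (λ_j² - μ)`, `w = ∑ λ_j b_j² / (λ_j² - μ)` and
`d = 1/4 + μ ∑ a_j b_j / (λ_j² - μ)` are the entries of a Lax matrix (`Fm_eq_coeff`). The whole proof
works with these generating functions, as formal power series in `μ`, over any complete
nontrivially normed field of characteristic zero, and is specialized to `ℝ` and `ℂ` at the end.

*Involution.* The canonical brackets of the entries at `μ` and `ν` are divided differences of the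
entries, which gives `{F_m, F_n} = 0` on the whole phase space, by an identity in `𝕜⟦μ⟧⟦ν⟧`
(`sum_bracket_eq_zero`, `poisson_Fm_Fm`). Moreover `{F, F_m} = 0` identically and `{H, F_m} = 0` where
`F = 0`, while `{F, H}` is a multiple of `G`; so the correction terms of the Dirac brackets vanish
on `M`. That `M` is symplectic is the equality `{F, G} = 4⟨Λq, p⟩`.

*Independence.* As `F` commutes with the integrals and not with `G`, the restrictions of the `dF_m` to
`T_z M` are independent as soon as `dF, dF_{-1}, …, dF_{-(N-1)}` are. For this it is enough to vary `b`
with `a` fixed: there are `N` variations for `N` functions, and one shows that a variation `β` along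
which all of them are stationary is zero (`IsGeneric.eq_zero`). Stationarity is an equality
`d A = u B` of rational functions, `A = ∑ β_j a_j / (λ_j² - μ)`, `B = ∑ β_j λ_j b_j / (λ_j² - μ)`: the
difference of the two sides has a numerator of degree at most `N - 2`, so that finitely many Taylor
coefficients determine it. If the numerators of `u` and `d` are coprime, the numerator of `u` divides
that of `A`, which has smaller degree, whence `A = B = 0`. This is separation of variables in disguise:
the zeros of `u` and the values of `d` there are local coordinates on a dense part of `M`. The `λ_j²` need not be distinct, so
denominators are reduced; when `λ_k = -λ_j` one needs also `a_j b_k + a_k b_j ≠ 0`.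

*Density.* For fixed `a` with nonzero entries these conditions exclude finitely many proper subspaces
of vectors `b` (`dense_generic`). They are invariant under rescaling `a` and `b` separately, and a
rescaling close to the identity carries a perturbed point back to `M` (`exists_isGeneric_mem`); its
factor is a fourth root of a number close to `1`, which exists over `ℝ` as well as over `ℂ`.
-/

open scoped Matrix ContDiff

namespace RestrictedMKdV

/-! ### Hamiltonian vector fields and the Dirac bracket -/

section
variable {𝕜 : Type*} [NontriviallyNormedField 𝕜] {N : ℕ}

/-- The differential is the pairing with the gradient; at a point where `f` is not differentiable
both sides vanish. -/
theorem fderiv_apply_eq (f : Phase 𝕜 N → 𝕜) (z v : Phase 𝕜 N) :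
    fderiv 𝕜 f z v = dq f z ⬝ᵥ v.1 + dp f z ⬝ᵥ v.2 := by
  have hv : v = ∑ j, v.1 j • ((Pi.single j 1, 0) : Phase 𝕜 N) +
      ∑ j, v.2 j • ((0, Pi.single j 1) : Phase 𝕜 N) := by
    ext j
    · simp [Prod.fst_sum, Finset.sum_apply, Pi.single_apply]
    · simp [Prod.snd_sum, Finset.sum_apply, Pi.single_apply]
  conv_lhs => rw [hv]
  simp only [map_add, map_sum, map_smul, smul_eq_mul, dotProduct, dq, dp]
  simp only [mul_comm]

/-- The canonical Hamiltonian vector field of `f`. -/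
noncomputable def hamField (f : Phase 𝕜 N → 𝕜) (z : Phase 𝕜 N) : Phase 𝕜 N := (dp f z, -dq f z)

theorem fderiv_hamField (f g : Phase 𝕜 N → 𝕜) (z : Phase 𝕜 N) :
    fderiv 𝕜 f z (hamField g z) = poisson f g z := by
  rw [fderiv_apply_eq, poisson, hamField, dotProduct_neg]; ring

theorem omega_hamField (f : Phase 𝕜 N → 𝕜) (z v : Phase 𝕜 N) :
    omega v (hamField f z) = -fderiv 𝕜 f z v := by
  rw [fderiv_apply_eq, omega, hamField, dotProduct_neg, dotProduct_comm v.1, dotProduct_comm v.2]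
  ring

theorem poisson_swap (f g : Phase 𝕜 N → 𝕜) (z : Phase 𝕜 N) : poisson f g z = -poisson g f z := by
  rw [poisson, poisson, dotProduct_comm (dq f z), dotProduct_comm (dp f z)]; ring

theorem poisson_self (f : Phase 𝕜 N → 𝕜) (z : Phase 𝕜 N) : poisson f f z = 0 := by
  rw [poisson, dotProduct_comm (dq f z)]; ring

theorem mem_tangentM {lam : Fin N → 𝕜} {z v : Phase 𝕜 N} :
    v ∈ tangentM lam z ↔ fderiv 𝕜 conF z v = 0 ∧ fderiv 𝕜 (conG lam) z v = 0 := by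
  simp [tangentM]

theorem dq_fst (j : Fin N) (z : Phase 𝕜 N) : dq (fun w => w.1 j) z = Pi.single j 1 := by
  have h : fderiv 𝕜 (fun w : Phase 𝕜 N => w.1 j) z =
      (ContinuousLinearMap.proj (R := 𝕜) (φ := fun _ : Fin N => 𝕜) j).comp
        (ContinuousLinearMap.fst 𝕜 _ _) :=
    ((ContinuousLinearMap.proj (R := 𝕜) (φ := fun _ : Fin N => 𝕜) j).comp
        (ContinuousLinearMap.fst 𝕜 (Fin N → 𝕜) (Fin N → 𝕜))).fderiv
  ext i
  simp [dq, h, Pi.single_apply, eq_comm]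

theorem dp_fst (j : Fin N) (z : Phase 𝕜 N) : dp (fun w => w.1 j) z = 0 := by
  have h : fderiv 𝕜 (fun w : Phase 𝕜 N => w.1 j) z =
      (ContinuousLinearMap.proj (R := 𝕜) (φ := fun _ : Fin N => 𝕜) j).comp
        (ContinuousLinearMap.fst 𝕜 _ _) :=
    ((ContinuousLinearMap.proj (R := 𝕜) (φ := fun _ : Fin N => 𝕜) j).comp
        (ContinuousLinearMap.fst 𝕜 (Fin N → 𝕜) (Fin N → 𝕜))).fderiv
  ext i
  simp [dp, h]

theorem dq_snd (j : Fin N) (z : Phase 𝕜 N) : dq (fun w => w.2 j) z = 0 := by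
  have h : fderiv 𝕜 (fun w : Phase 𝕜 N => w.2 j) z =
      (ContinuousLinearMap.proj (R := 𝕜) (φ := fun _ : Fin N => 𝕜) j).comp
        (ContinuousLinearMap.snd 𝕜 _ _) :=
    ((ContinuousLinearMap.proj (R := 𝕜) (φ := fun _ : Fin N => 𝕜) j).comp
        (ContinuousLinearMap.snd 𝕜 (Fin N → 𝕜) (Fin N → 𝕜))).fderiv
  ext i
  simp [dq, h]

theorem dp_snd (j : Fin N) (z : Phase 𝕜 N) : dp (fun w => w.2 j) z = Pi.single j 1 := by
  have h : fderiv 𝕜 (fun w : Phase 𝕜 N => w.2 j) z =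
      (ContinuousLinearMap.proj (R := 𝕜) (φ := fun _ : Fin N => 𝕜) j).comp
        (ContinuousLinearMap.snd 𝕜 _ _) :=
    ((ContinuousLinearMap.proj (R := 𝕜) (φ := fun _ : Fin N => 𝕜) j).comp
        (ContinuousLinearMap.snd 𝕜 (Fin N → 𝕜) (Fin N → 𝕜))).fderiv
  ext i
  simp [dp, h, Pi.single_apply, eq_comm]

/-- The field of `(h)_D` as a combination of canonical Hamiltonian fields. -/
theorem diracField_eq (lam : Fin N → 𝕜) (h : Phase 𝕜 N → 𝕜) (z : Phase 𝕜 N) :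
    diracField lam h z = hamField h z + (1 / (4 * (Lam lam 1 z.1 ⬝ᵥ z.2))) •
      (poisson (conG lam) h z • hamField conF z - poisson conF h z • hamField (conG lam) z) := by
  ext j
  · simp only [diracField, dirac, poisson, dq_fst, dp_fst, hamField]
    simp [-mul_eq_mul_left_iff]
    ring
  · simp only [diracField, dirac, poisson, dq_snd, dp_snd, hamField]
    simp [-mul_eq_mul_left_iff]
    ring

/-! ### Differentials of the quadratic functions -/

theorem hasDerivAt_pairing (lam : Fin N → 𝕜) (k : ℤ) (x v y w : Fin N → 𝕜) :
    HasDerivAt (fun t : 𝕜 => Lam lam k (x + t • v) ⬝ᵥ (y + t • w))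
      (Lam lam k v ⬝ᵥ y + Lam lam k x ⬝ᵥ w) 0 := by
  simp only [dotProduct, Lam, Pi.add_apply, Pi.smul_apply, smul_eq_mul, ← Finset.sum_add_distrib]
  refine HasDerivAt.fun_sum fun j _ => ?_
  have h1 : HasDerivAt (fun t : 𝕜 => lam j ^ k * (x j + t * v j)) (lam j ^ k * v j) 0 := by
    simpa using (((hasDerivAt_id (0 : 𝕜)).mul_const (v j)).const_add (x j)).const_mul (lam j ^ k)
  have h2 : HasDerivAt (fun t : 𝕜 => y j + t * w j) (w j) 0 := by
    simpa using ((hasDerivAt_id (0 : 𝕜)).mul_const (w j)).const_add (y j)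
  simpa using h1.fun_mul h2

theorem Lam_zero (lam : Fin N → 𝕜) (x : Fin N → 𝕜) : Lam lam 0 x = x := by
  ext j; simp [Lam]

theorem fderiv_eq_of_hasDerivAt {f : Phase 𝕜 N → 𝕜} {z v : Phase 𝕜 N} {L : 𝕜}
    (hf : DifferentiableAt 𝕜 f z) (h : HasDerivAt (fun t : 𝕜 => f (z + t • v)) L 0) :
    fderiv 𝕜 f z v = L := by
  rw [← hf.lineDeriv_eq_fderiv]
  exact HasLineDerivAt.lineDeriv h

theorem contDiff_conF : ContDiff 𝕜 ∞ (conF (𝕜 := 𝕜) (N := N)) := by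
  unfold conF dotProduct; fun_prop

theorem contDiff_conG (lam : Fin N → 𝕜) : ContDiff 𝕜 ∞ (conG lam) := by
  unfold conG Lam dotProduct; simp only [div_eq_mul_inv]; fun_prop

theorem contDiff_realH (lam : Fin N → 𝕜) : ContDiff 𝕜 ∞ (realH lam) := by
  unfold realH Lam dotProduct; fun_prop

theorem contDiff_Fm (lam : Fin N → 𝕜) (m : ℤ) : ContDiff 𝕜 ∞ (Fm lam m) := by
  unfold Fm
  simp only [Matrix.det_fin_two_of, Lam, dotProduct]
  fun_prop

theorem fderiv_conF (z v : Phase 𝕜 N) :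
    fderiv 𝕜 conF z v = 2 * (z.1 ⬝ᵥ v.1) - 2 * (z.2 ⬝ᵥ v.2) := by
  refine fderiv_eq_of_hasDerivAt (contDiff_conF.differentiable (by simp) z) ?_
  have h := ((hasDerivAt_pairing (1 : Fin N → 𝕜) 0 z.1 v.1 z.1 v.1).sub
    (hasDerivAt_pairing (1 : Fin N → 𝕜) 0 z.2 v.2 z.2 v.2)).sub_const (1 / 4 : 𝕜)
  simp only [Lam_zero] at h
  refine h.congr_deriv ?_
  rw [dotProduct_comm v.1, dotProduct_comm v.2]; ring

theorem Lam_dotProduct_comm (lam : Fin N → 𝕜) (k : ℤ) (x y : Fin N → 𝕜) :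
    Lam lam k x ⬝ᵥ y = Lam lam k y ⬝ᵥ x := by
  simp only [Lam, dotProduct]
  exact Finset.sum_congr rfl fun _ _ => by ring

theorem fderiv_realH (lam : Fin N → 𝕜) (z v : Phase 𝕜 N) :
    fderiv 𝕜 (realH lam) z v = Lam lam 1 z.2 ⬝ᵥ v.1 + Lam lam 1 z.1 ⬝ᵥ v.2 := by
  refine fderiv_eq_of_hasDerivAt ((contDiff_realH lam).differentiable (by simp) z) ?_
  refine (hasDerivAt_pairing lam 1 z.1 v.1 z.2 v.2).congr_deriv ?_
  rw [Lam_dotProduct_comm lam 1 v.1]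

theorem fderiv_conG [CharZero 𝕜] (lam : Fin N → 𝕜) (z v : Phase 𝕜 N) :
    fderiv 𝕜 (conG lam) z v = Lam lam 1 z.1 ⬝ᵥ v.1 + Lam lam 1 z.2 ⬝ᵥ v.2 := by
  refine fderiv_eq_of_hasDerivAt ((contDiff_conG lam).differentiable (by simp) z) ?_
  refine (((hasDerivAt_pairing lam 1 z.1 v.1 z.1 v.1).add
    (hasDerivAt_pairing lam 1 z.2 v.2 z.2 v.2)).div_const 2).congr_deriv ?_
  rw [Lam_dotProduct_comm lam 1 v.1, Lam_dotProduct_comm lam 1 v.2]; ring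

theorem dq_conF (z : Phase 𝕜 N) (j : Fin N) : dq conF z j = 2 * z.1 j := by
  simp [dq, fderiv_conF]

theorem dp_conF (z : Phase 𝕜 N) (j : Fin N) : dp conF z j = -(2 * z.2 j) := by
  simp [dp, fderiv_conF]

theorem dq_realH (lam : Fin N → 𝕜) (z : Phase 𝕜 N) (j : Fin N) :
    dq (realH lam) z j = lam j * z.2 j := by
  simp [dq, fderiv_realH, Lam]

theorem dp_realH (lam : Fin N → 𝕜) (z : Phase 𝕜 N) (j : Fin N) :
    dp (realH lam) z j = lam j * z.1 j := by
  simp [dp, fderiv_realH, Lam]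

variable [CharZero 𝕜]

theorem dq_conG (lam : Fin N → 𝕜) (z : Phase 𝕜 N) (j : Fin N) :
    dq (conG lam) z j = lam j * z.1 j := by
  simp [dq, fderiv_conG, Lam]

theorem dp_conG (lam : Fin N → 𝕜) (z : Phase 𝕜 N) (j : Fin N) :
    dp (conG lam) z j = lam j * z.2 j := by
  simp [dp, fderiv_conG, Lam]

theorem poisson_conF_conG (lam : Fin N → 𝕜) (z : Phase 𝕜 N) :
    poisson conF (conG lam) z = 4 * (Lam lam 1 z.1 ⬝ᵥ z.2) := by
  simp only [poisson, dotProduct, dq_conF, dp_conF, dq_conG, dp_conG, Lam, zpow_one,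
    ← Finset.sum_sub_distrib, Finset.mul_sum]
  exact Finset.sum_congr rfl fun _ _ => by ring

theorem poisson_conF_realH {lam : Fin N → 𝕜} {z : Phase 𝕜 N} (hz : conG lam z = 0) :
    poisson conF (realH lam) z = 0 := by
  have : poisson conF (realH lam) z = 4 * conG lam z := by
    simp only [poisson, conG, dotProduct, dq_conF, dp_conF, dq_realH, dp_realH, Lam, zpow_one,
      ← Finset.sum_sub_distrib, ← Finset.sum_add_distrib, Finset.mul_sum, Finset.sum_div]
    exact Finset.sum_congr rfl fun _ _ => by ring
  rw [this, hz, mul_zero]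

theorem poisson_conG_realH (lam : Fin N → 𝕜) (z : Phase 𝕜 N) :
    poisson (conG lam) (realH lam) z = Lam lam 2 z.1 ⬝ᵥ z.1 - Lam lam 2 z.2 ⬝ᵥ z.2 := by
  simp only [poisson, dotProduct, dq_conG, dp_conG, dq_realH, dp_realH, Lam,
    ← Finset.sum_sub_distrib]
  exact Finset.sum_congr rfl fun _ _ => by rw [zpow_ofNat]; ring

/-! ### The symplectic structure of `M` -/

/-- Adding multiples of the Hamiltonian fields of the two constraints carries any vector into
`T_z M`, because `{F, G} ≠ 0`. -/
theorem exists_projection {lam : Fin N → 𝕜} {z : Phase 𝕜 N} (hz : z ∈ M lam) (w : Phase 𝕜 N) :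
    ∃ α : 𝕜, w + α • hamField conF z -
      (fderiv 𝕜 conF z w / (4 * (Lam lam 1 z.1 ⬝ᵥ z.2))) • hamField (conG lam) z ∈
        tangentM lam z := by
  have hc : (Lam lam 1 z.1 ⬝ᵥ z.2) ≠ 0 := hz.2.2
  refine ⟨fderiv 𝕜 (conG lam) z w / (4 * (Lam lam 1 z.1 ⬝ᵥ z.2)), mem_tangentM.2 ⟨?_, ?_⟩⟩
  · simp only [map_add, map_sub, map_smul, fderiv_hamField, poisson_self, poisson_conF_conG,
      smul_eq_mul]
    field_simp
    ring
  · simp only [map_add, map_sub, map_smul, fderiv_hamField, poisson_self,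
      poisson_swap (conG lam) conF, poisson_conF_conG, smul_eq_mul]
    field_simp
    ring

theorem isSymplecticM (lam : Fin N → 𝕜) : IsSymplecticM lam := by
  intro z hz
  have hc : (4 * (Lam lam 1 z.1 ⬝ᵥ z.2)) ≠ 0 := mul_ne_zero (by norm_num) hz.2.2
  constructor
  · rw [LinearIndependent.pair_iff]
    intro s t hst
    have h1 := congrArg (fun L : Phase 𝕜 N →L[𝕜] 𝕜 => L (hamField conF z)) hst
    have h2 := congrArg (fun L : Phase 𝕜 N →L[𝕜] 𝕜 => L (hamField (conG lam) z)) hst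
    simp only [add_apply, smul_apply, fderiv_hamField,
      poisson_self, poisson_swap (conG lam) conF, poisson_conF_conG, smul_eq_mul, mul_zero,
      zero_add, add_zero, zero_apply, mul_neg, neg_eq_zero] at h1 h2
    exact ⟨(mul_eq_zero.1 h2).resolve_right hc, (mul_eq_zero.1 h1).resolve_right hc⟩
  · intro v hv h
    have key : ∀ w, omega v w = 0 := by
      intro w
      obtain ⟨α, hα⟩ := exists_projection hz w
      have h0 := h _ hα
      obtain ⟨hF, hG⟩ := mem_tangentM.1 hv
      have e1 := omega_hamField conF z v
      have e2 := omega_hamField (conG lam) z v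
      rw [hF] at e1
      rw [hG] at e2
      simp only [omega] at h0 e1 e2 ⊢
      simp only [Prod.fst_add, Prod.fst_sub, Prod.snd_add, Prod.snd_sub, Prod.smul_fst,
        Prod.smul_snd, dotProduct_add, dotProduct_sub, dotProduct_smul, smul_eq_mul] at h0
      linear_combination h0 - α * e1 +
        (fderiv 𝕜 conF z w / (4 * (Lam lam 1 z.1 ⬝ᵥ z.2))) * e2
    ext j
    · simpa [omega] using key (0, Pi.single j 1)
    · simpa [omega] using key (Pi.single j 1, 0)

theorem diracField_mem_tangentM {lam : Fin N → 𝕜} {z : Phase 𝕜 N} (hz : z ∈ M lam)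
    (h : Phase 𝕜 N → 𝕜) : diracField lam h z ∈ tangentM lam z := by
  have hc : (Lam lam 1 z.1 ⬝ᵥ z.2) ≠ 0 := hz.2.2
  rw [mem_tangentM, diracField_eq]
  constructor
  · simp only [map_add, map_sub, map_smul, fderiv_hamField, poisson_self, poisson_conF_conG,
      smul_eq_mul]
    field_simp
    ring
  · simp only [map_add, map_sub, map_smul, fderiv_hamField, poisson_self,
      poisson_swap (conG lam) conF, poisson_conF_conG, smul_eq_mul]
    field_simp
    ring

/-- On `M` the Hamiltonian field of `⟨Λq, p⟩` for the Dirac bracket is the restricted MKdV flow. -/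
theorem realField_eq_diracField {lam : Fin N → 𝕜} {z : Phase 𝕜 N} (hz : z ∈ M lam) :
    realField lam z = diracField lam (realH lam) z := by
  have hc : (Lam lam 1 z.1 ⬝ᵥ z.2) ≠ 0 := hz.2.2
  rw [diracField_eq, poisson_conF_realH hz.2.1, poisson_conG_realH]
  have hp : potential lam z = 2 * (1 / (4 * (Lam lam 1 z.1 ⬝ᵥ z.2)) *
      (Lam lam 2 z.1 ⬝ᵥ z.1 - Lam lam 2 z.2 ⬝ᵥ z.2)) := by
    rw [potential]; field_simp; ring
  ext j
  · simp [realField, hamField, dp_realH, dp_conF, hp, Lam]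
    ring
  · simp [realField, hamField, dq_realH, dq_conF, hp, Lam]
    ring

end

/-! ### Generating series -/

section
open PowerSeries

variable {𝕜 : Type*} [Field 𝕜] {N : ℕ}

/-- The power series `1 / (λ_j² - X)`. -/
noncomputable def res (lam : Fin N → 𝕜) (j : Fin N) : 𝕜⟦X⟧ :=
  PowerSeries.mk fun k => (lam j ^ (2 * (k + 1)))⁻¹

/-- The power series `∑ c_j / (λ_j² - X)`. -/
noncomputable def poleSum (lam c : Fin N → 𝕜) : 𝕜⟦X⟧ := ∑ j, C (c j) * res lam j

/-- `⟨Λa, a / (Λ² - X)⟩` with `a = q - p`: an off-diagonal entry of the Lax matrix. -/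
noncomputable def genU (lam : Fin N → 𝕜) (z : Phase 𝕜 N) : 𝕜⟦X⟧ :=
  poleSum lam fun j => lam j * (z.1 j - z.2 j) ^ 2

/-- `⟨Λb, b / (Λ² - X)⟩` with `b = q + p`: the other off-diagonal entry of the Lax matrix. -/
noncomputable def genW (lam : Fin N → 𝕜) (z : Phase 𝕜 N) : 𝕜⟦X⟧ :=
  poleSum lam fun j => lam j * (z.1 j + z.2 j) ^ 2

/-- `1/4 + X ⟨a, b / (Λ² - X)⟩` with `a = q - p`, `b = q + p`: the diagonal entry of the Lax
matrix. -/
noncomputable def genD (lam : Fin N → 𝕜) (z : Phase 𝕜 N) : 𝕜⟦X⟧ :=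
  C (1 / 4) + X * poleSum lam fun j => (z.1 j - z.2 j) * (z.1 j + z.2 j)

/-- The determinant of the Lax matrix, up to a factor. The coefficient of `Xⁿ` is `F_{-n}`
for `n ≥ 1`. -/
noncomputable def genF (lam : Fin N → 𝕜) (z : Phase 𝕜 N) : 𝕜⟦X⟧ :=
  C (1 / 4) * (X * (genU lam z * genW lam z) - genD lam z * genD lam z)

/-- Up to the factor `-1/2`, the partial derivative of `genF` in the coordinate `a_j = q_j - p_j`
of the coordinate system `(q - p, q + p)`. -/
noncomputable def gradA (lam : Fin N → 𝕜) (z : Phase 𝕜 N) (j : Fin N) : 𝕜⟦X⟧ :=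
  X * (res lam j * (genD lam z * C (z.1 j + z.2 j) -
    C (lam j) * genW lam z * C (z.1 j - z.2 j)))

/-- Up to the factor `-1/2`, the partial derivative of `genF` in the coordinate `b_j = q_j + p_j`
of the coordinate system `(q - p, q + p)`. -/
noncomputable def gradB (lam : Fin N → 𝕜) (z : Phase 𝕜 N) (j : Fin N) : 𝕜⟦X⟧ :=
  X * (res lam j * (genD lam z * C (z.1 j - z.2 j) -
    C (lam j) * genU lam z * C (z.1 j + z.2 j)))

theorem sub_mul_res {lam : Fin N → 𝕜} {j : Fin N} (h : lam j ≠ 0) :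
    (C (lam j) ^ 2 - X) * res lam j = 1 := by
  ext k
  rw [sub_mul, ← map_pow, map_sub, coeff_C_mul]
  cases k with
  | zero => simp [res, h]
  | succ k =>
    simp only [coeff_succ_X_mul, res, coeff_mk, coeff_one]
    simp only [Nat.add_eq_zero_iff, one_ne_zero, and_false, if_false]
    field_simp
    ring

theorem coeff_poleSum (lam c : Fin N → 𝕜) (k : ℕ) :
    coeff k (poleSum lam c) = ∑ j, c j * (lam j ^ (2 * (k + 1)))⁻¹ := by
  simp [poleSum, res]

theorem sum_Icc_reindex {R : Type*} [AddCommMonoid R] (c : ℤ) (n : ℕ) (f : ℤ → R) :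
    ∑ j ∈ Finset.Icc (c - n) (c - 1), f j = ∑ i ∈ Finset.range n, f (c - 1 - i) := by
  refine Finset.sum_nbij' (fun j => (c - 1 - j).toNat) (fun i => c - 1 - i) ?_ ?_ ?_ ?_ ?_
  · intro j hj; simp only [Finset.mem_Icc, Finset.mem_range] at *; omega
  · intro j hj; simp only [Finset.mem_Icc, Finset.mem_range] at *; omega
  · intro j hj; simp only [Finset.mem_Icc] at *; omega
  · intro j hj; simp only [Finset.mem_range] at *; omega
  · intro j hj
    simp only [Finset.mem_Icc] at hj
    congr 1; omega

theorem coeff_mul_range (n : ℕ) (f g : 𝕜⟦X⟧) :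
    coeff n (f * g) = ∑ i ∈ Finset.range (n + 1), coeff i f * coeff (n - i) g := by
  rw [coeff_mul, Finset.Nat.sum_antidiagonal_eq_sum_range_succ_mk]

theorem coeff_X_mul_mul (n : ℕ) (f g : 𝕜⟦X⟧) :
    coeff n (X * (f * g)) = ∑ i ∈ Finset.range n, coeff i f * coeff (n - 1 - i) g := by
  cases n with
  | zero => simp
  | succ n => rw [coeff_succ_X_mul, coeff_mul_range]; rfl

end

section
open PowerSeries

variable {𝕜 : Type*} [NontriviallyNormedField 𝕜] [CharZero 𝕜] {N : ℕ}

theorem Lam_dotProduct_even (lam x : Fin N → 𝕜) {e : ℤ} {k : ℕ} (he : e = -(2 * (k + 1) : ℕ)) :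
    Lam lam e x ⬝ᵥ x = ∑ j, x j ^ 2 * (lam j ^ (2 * (k + 1)))⁻¹ := by
  simp only [Lam, dotProduct, he, zpow_neg, zpow_natCast]
  exact Finset.sum_congr rfl fun j _ => by ring

omit [CharZero 𝕜] in
theorem Lam_dotProduct_odd {lam : Fin N → 𝕜} (hl : ∀ j, lam j ≠ 0) (x y : Fin N → 𝕜) {e : ℤ}
    {k : ℕ} (he : e = -(2 * k + 1 : ℕ)) :
    Lam lam e x ⬝ᵥ y = ∑ j, lam j * (x j * y j) * (lam j ^ (2 * (k + 1)))⁻¹ := by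
  simp only [Lam, dotProduct, he, zpow_neg, zpow_natCast]
  refine Finset.sum_congr rfl fun j _ => ?_
  have := hl j
  field_simp
  ring

/-- `F_{-n}` is a Taylor coefficient of the determinant of the Lax matrix. -/
theorem Fm_eq_coeff {lam : Fin N → 𝕜} (hl : ∀ j, lam j ≠ 0) (n : ℕ) (z : Phase 𝕜 N) :
    Fm lam (-(n + 1 : ℕ)) z = coeff (n + 1) (genF lam z) := by
  set P : 𝕜⟦X⟧ := poleSum lam fun j => (z.1 j - z.2 j) * (z.1 j + z.2 j) with hP
  have hD : ∀ k : ℕ, ∀ e : ℤ, e = -(2 * (k + 1) : ℕ) →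
      Lam lam e z.1 ⬝ᵥ z.1 - Lam lam e z.2 ⬝ᵥ z.2 = coeff k P := by
    intro k e he
    rw [Lam_dotProduct_even _ _ he, Lam_dotProduct_even _ _ he, hP, coeff_poleSum,
      ← Finset.sum_sub_distrib]
    exact Finset.sum_congr rfl fun j _ => by ring
  have hS : ∀ k : ℕ, ∀ e : ℤ, e = -(2 * k + 1 : ℕ) →
      Lam lam e z.1 ⬝ᵥ z.1 + Lam lam e z.2 ⬝ᵥ z.2 =
        (coeff k (genU lam z) + coeff k (genW lam z)) / 2 := by
    intro k e he
    rw [Lam_dotProduct_odd hl _ _ he, Lam_dotProduct_odd hl _ _ he, genU, genW, coeff_poleSum,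
      coeff_poleSum, ← Finset.sum_add_distrib, ← Finset.sum_add_distrib, Finset.sum_div]
    exact Finset.sum_congr rfl fun j _ => by ring
  have hC : ∀ k : ℕ, ∀ e : ℤ, e = -(2 * k + 1 : ℕ) → 2 * (Lam lam e z.1 ⬝ᵥ z.2) =
        (coeff k (genW lam z) - coeff k (genU lam z)) / 2 := by
    intro k e he
    rw [Lam_dotProduct_odd hl _ _ he, genU, genW, coeff_poleSum,
      coeff_poleSum, ← Finset.sum_sub_distrib, Finset.sum_div, Finset.mul_sum]
    exact Finset.sum_congr rfl fun j _ => by ring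
  have hrhs : coeff (n + 1) (genF lam z) = -(1 / 8) * coeff n P
      - 1 / 4 * ∑ i ∈ Finset.range n, coeff i P * coeff (n - 1 - i) P
      + 1 / 8 * (∑ i ∈ Finset.range (n + 1), coeff i (genU lam z) * coeff (n - i) (genW lam z)
        + ∑ i ∈ Finset.range (n + 1), coeff i (genW lam z) * coeff (n - i) (genU lam z)) := by
    rw [← coeff_X_mul_mul, ← coeff_mul_range, ← coeff_mul_range, mul_comm (genW lam z)]
    have : genF lam z = C (1 / 4) * (X * (genU lam z * genW lam z)) - C (1 / 4 * (1 / 16))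
        - C (1 / 8) * (X * P) - C (1 / 4) * (X * (X * (P * P))) := by
      have e1 : (C (1 / 8) : 𝕜⟦X⟧) = 2 * (C (1 / 4) * C (1 / 4)) := by
        rw [← map_ofNat (C (R := 𝕜)) 2, ← map_mul, ← map_mul]; congr 1; norm_num
      have e2 : (C (1 / 4 * (1 / 16)) : 𝕜⟦X⟧) = C (1 / 4) * (C (1 / 4) * C (1 / 4)) := by
        rw [← map_mul, ← map_mul]; congr 1; norm_num
      rw [genF, genD, ← hP, e1, e2]
      ring
    rw [this]
    simp only [map_sub, coeff_C_mul, coeff_succ_X_mul]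
    rw [coeff_C, if_neg (Nat.succ_ne_zero n)]
    ring
  rw [hrhs]
  unfold Fm
  simp only [Matrix.det_fin_two_of]
  have i1 := sum_Icc_reindex (-1) n fun j : ℤ =>
      (Lam lam (2 * (j + 1)) z.1 ⬝ᵥ z.1 - Lam lam (2 * (j + 1)) z.2 ⬝ᵥ z.2) *
      (Lam lam (2 * (-(n + 1 : ℕ) - j - 1)) z.2 ⬝ᵥ z.2
        - Lam lam (2 * (-(n + 1 : ℕ) - j - 1)) z.1 ⬝ᵥ z.1)
  have i2 := sum_Icc_reindex 0 (n + 1) fun j : ℤ =>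
      (Lam lam (2 * j + 1) z.1 ⬝ᵥ z.1 + Lam lam (2 * j + 1) z.2 ⬝ᵥ z.2) *
        (Lam lam (2 * (-(n + 1 : ℕ) - j) - 1) z.1 ⬝ᵥ z.1
          + Lam lam (2 * (-(n + 1 : ℕ) - j) - 1) z.2 ⬝ᵥ z.2) -
      2 * (Lam lam (2 * (-(n + 1 : ℕ) - j) - 1) z.2 ⬝ᵥ z.1) *
        (2 * (Lam lam (2 * j + 1) z.1 ⬝ᵥ z.2))
  rw [show (-1 - n : ℤ) = -(n + 1 : ℕ) by push_cast; ring, show (-1 - 1 : ℤ) = -2 by norm_num] at i1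
  rw [show (0 - (n + 1 : ℕ) : ℤ) = -(n + 1 : ℕ) by ring, show (0 - 1 : ℤ) = -1 by norm_num] at i2
  rw [i1, i2]
  have j1 : ∑ i ∈ Finset.range n, coeff i P * coeff (n - 1 - i) P =
      -∑ i ∈ Finset.range n,
        (Lam lam (2 * (-2 - (i : ℤ) + 1)) z.1 ⬝ᵥ z.1 - Lam lam (2 * (-2 - i + 1)) z.2 ⬝ᵥ z.2) *
        (Lam lam (2 * (-(n + 1 : ℕ) - (-2 - i) - 1)) z.2 ⬝ᵥ z.2
          - Lam lam (2 * (-(n + 1 : ℕ) - (-2 - i) - 1)) z.1 ⬝ᵥ z.1) := by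
    rw [← Finset.sum_neg_distrib]
    refine Finset.sum_congr rfl fun i hi => ?_
    rw [Finset.mem_range] at hi
    rw [← hD i (2 * (-2 - (i : ℤ) + 1)) (by push_cast; ring),
      ← hD (n - 1 - i) (2 * (-(n + 1 : ℕ) - (-2 - i) - 1)) (by omega)]
    ring
  have j2 : ∑ i ∈ Finset.range (n + 1), coeff i (genU lam z) * coeff (n - i) (genW lam z)
        + ∑ i ∈ Finset.range (n + 1), coeff i (genW lam z) * coeff (n - i) (genU lam z) =
      2 * ∑ i ∈ Finset.range (n + 1),
      ((Lam lam (2 * (-1 - (i : ℤ)) + 1) z.1 ⬝ᵥ z.1 + Lam lam (2 * (-1 - (i : ℤ)) + 1) z.2 ⬝ᵥ z.2) *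
        (Lam lam (2 * (-(n + 1 : ℕ) - (-1 - (i : ℤ))) - 1) z.1 ⬝ᵥ z.1
          + Lam lam (2 * (-(n + 1 : ℕ) - (-1 - (i : ℤ))) - 1) z.2 ⬝ᵥ z.2) -
      2 * (Lam lam (2 * (-(n + 1 : ℕ) - (-1 - (i : ℤ))) - 1) z.2 ⬝ᵥ z.1) *
        (2 * (Lam lam (2 * (-1 - (i : ℤ)) + 1) z.1 ⬝ᵥ z.2))) := by
    rw [← Finset.sum_add_distrib, Finset.mul_sum]
    refine Finset.sum_congr rfl fun i hi => ?_
    rw [Finset.mem_range] at hi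
    have e1 : (2 * (-1 - (i : ℤ)) + 1) = -(2 * i + 1 : ℕ) := by push_cast; ring
    have e2 : (2 * (-(n + 1 : ℕ) - (-1 - (i : ℤ))) - 1) = -(2 * (n - i) + 1 : ℕ) := by omega
    rw [Lam_dotProduct_comm lam _ z.2 z.1, hS i _ e1, hS _ _ e2, hC i _ e1, hC _ _ e2]
    ring
  rw [j1, j2, ← hD n (2 * -(n + 1 : ℕ)) (by push_cast; ring)]
  ring

/-! ### Differentials of the integrals -/

omit [CharZero 𝕜] in
theorem hasDerivAt_coeff_mul {f g : 𝕜 → 𝕜⟦X⟧} {f' g' : 𝕜⟦X⟧} {t : 𝕜}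
    (hf : ∀ k, HasDerivAt (fun s => coeff k (f s)) (coeff k f') t)
    (hg : ∀ k, HasDerivAt (fun s => coeff k (g s)) (coeff k g') t) (k : ℕ) :
    HasDerivAt (fun s => coeff k (f s * g s)) (coeff k (f' * g t + f t * g')) t := by
  simp only [map_add, coeff_mul, ← Finset.sum_add_distrib]
  exact HasDerivAt.fun_sum fun i _ => (hf i.1).fun_mul (hg i.2)

omit [CharZero 𝕜] in
theorem hasDerivAt_coeff_X_mul {f : 𝕜 → 𝕜⟦X⟧} {f' : 𝕜⟦X⟧} {t : 𝕜}
    (hf : ∀ k, HasDerivAt (fun s => coeff k (f s)) (coeff k f') t) (k : ℕ) :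
    HasDerivAt (fun s => coeff k (X * f s)) (coeff k (X * f')) t := by
  cases k with
  | zero => simpa using hasDerivAt_const t (0 : 𝕜)
  | succ k => simpa only [coeff_succ_X_mul] using hf k

omit [CharZero 𝕜] in
theorem hasDerivAt_coeff_poleSum (lam : Fin N → 𝕜) {c : 𝕜 → Fin N → 𝕜} {c' : Fin N → 𝕜} {t : 𝕜}
    (hc : ∀ j, HasDerivAt (fun s => c s j) (c' j) t) (k : ℕ) :
    HasDerivAt (fun s => coeff k (poleSum lam (c s))) (coeff k (poleSum lam c')) t := by
  simp only [coeff_poleSum]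
  exact HasDerivAt.fun_sum fun j _ => (hc j).mul_const _

theorem fderiv_Fm {lam : Fin N → 𝕜} (hl : ∀ j, lam j ≠ 0) (n : ℕ) (z v : Phase 𝕜 N) :
    fderiv 𝕜 (Fm lam (-(n + 1 : ℕ))) z v = -(1 / 2) * ∑ j,
      (coeff (n + 1) (gradA lam z j) * (v.1 j - v.2 j) +
        coeff (n + 1) (gradB lam z j) * (v.1 j + v.2 j)) := by
  refine fderiv_eq_of_hasDerivAt ((contDiff_Fm lam _).differentiable (by simp) z) ?_
  simp only [Fm_eq_coeff hl]
  have h1 : ∀ j, HasDerivAt (fun t : 𝕜 => (z + t • v).1 j - (z + t • v).2 j)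
      (v.1 j - v.2 j) 0 := by
    intro j
    have h : HasDerivAt (fun t : 𝕜 => (z.1 j + t * v.1 j) - (z.2 j + t * v.2 j))
        (1 * v.1 j - 1 * v.2 j) 0 :=
      (((hasDerivAt_id' (0 : 𝕜)).mul_const (v.1 j)).const_add (z.1 j)).fun_sub
        (((hasDerivAt_id' (0 : 𝕜)).mul_const (v.2 j)).const_add (z.2 j))
    simpa using h
  have h2 : ∀ j, HasDerivAt (fun t : 𝕜 => (z + t • v).1 j + (z + t • v).2 j)
      (v.1 j + v.2 j) 0 := by
    intro j
    have h : HasDerivAt (fun t : 𝕜 => (z.1 j + t * v.1 j) + (z.2 j + t * v.2 j))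
        (1 * v.1 j + 1 * v.2 j) 0 :=
      (((hasDerivAt_id' (0 : 𝕜)).mul_const (v.1 j)).const_add (z.1 j)).fun_add
        (((hasDerivAt_id' (0 : 𝕜)).mul_const (v.2 j)).const_add (z.2 j))
    simpa using h
  have hU := hasDerivAt_coeff_poleSum lam (c := fun (t : 𝕜) j =>
    lam j * ((z + t • v).1 j - (z + t • v).2 j) ^ 2) fun j => ((h1 j).fun_pow 2).const_mul (lam j)
  have hW := hasDerivAt_coeff_poleSum lam (c := fun (t : 𝕜) j =>
    lam j * ((z + t • v).1 j + (z + t • v).2 j) ^ 2) fun j => ((h2 j).fun_pow 2).const_mul (lam j)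
  have hP := hasDerivAt_coeff_poleSum lam (c := fun (t : 𝕜) j =>
    ((z + t • v).1 j - (z + t • v).2 j) * ((z + t • v).1 j + (z + t • v).2 j))
    fun j => (h1 j).fun_mul (h2 j)
  have hD : ∀ k, HasDerivAt (fun t : 𝕜 => coeff k (genD lam (z + t • v))) _ 0 := fun k =>
    (hasDerivAt_coeff_X_mul hP k).const_add (coeff k (C (1 / 4)))
  have hF := ((hasDerivAt_coeff_X_mul (hasDerivAt_coeff_mul hU hW) (n + 1)).fun_sub
    (hasDerivAt_coeff_mul hD hD (n + 1))).const_mul (1 / 4 : 𝕜)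
  have hfun : (fun t : 𝕜 => coeff (n + 1) (genF lam (z + t • v))) = fun t =>
      1 / 4 * (coeff (n + 1) (X * (genU lam (z + t • v) * genW lam (z + t • v))) -
        coeff (n + 1) (genD lam (z + t • v) * genD lam (z + t • v))) := by
    funext t
    rw [genF, coeff_C_mul, map_sub]
  rw [hfun]
  refine hF.congr_deriv ?_
  simp only [zero_smul, add_zero]
  simp only [← coeff_mul_C, ← map_add, ← map_sub, ← map_sum, ← coeff_C_mul]
  congr 1
  have e1 : (C (-(1 / 2)) : 𝕜⟦X⟧) = -(2 * C (1 / 4)) := by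
    rw [← map_ofNat (C (R := 𝕜)) 2, ← map_mul, ← map_neg]; congr 1; norm_num
  have e2 : ∀ f : 𝕜⟦X⟧, C (-(1 / 2)) * f = C (1 / 4) * -(2 * f) := fun f => by rw [e1]; ring
  rw [e2]
  congr 1
  simp only [gradA, gradB]
  change X * (_ * genW lam z + genU lam z * _) - (_ * genD lam z + genD lam z * _) = _
  simp only [poleSum, Finset.mul_sum, Finset.sum_mul, ← Finset.sum_add_distrib,
    ← Finset.sum_sub_distrib, ← Finset.sum_neg_distrib]
  refine Finset.sum_congr rfl fun j _ => ?_
  simp only [map_mul, map_add, map_sub, map_pow, map_natCast]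
  push_cast
  ring

theorem dq_Fm {lam : Fin N → 𝕜} (hl : ∀ j, lam j ≠ 0) (n : ℕ) (z : Phase 𝕜 N) (j : Fin N) :
    dq (Fm lam (-(n + 1 : ℕ))) z j = -(1 / 2) *
      (coeff (n + 1) (gradB lam z j) + coeff (n + 1) (gradA lam z j)) := by
  rw [dq, fderiv_Fm hl]
  simp [Pi.single_apply, Finset.sum_add_distrib]
  ring

theorem dp_Fm {lam : Fin N → 𝕜} (hl : ∀ j, lam j ≠ 0) (n : ℕ) (z : Phase 𝕜 N) (j : Fin N) :
    dp (Fm lam (-(n + 1 : ℕ))) z j = -(1 / 2) *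
      (coeff (n + 1) (gradB lam z j) - coeff (n + 1) (gradA lam z j)) := by
  rw [dp, fderiv_Fm hl]
  simp [Pi.single_apply, Finset.sum_add_distrib]
  ring

/-! ### Involution -/

/-- The involution of the Gaudin-type generating functions at two different values `μ`, `ν` of the
spectral parameter: each difference `f(μ) - f(ν)` of Lax entries is `(μ - ν)` times a sum over
`r_j r'_j`, and after this substitution everything cancels. -/
theorem sum_bracket_eq_zero {R ι : Type*} [CommRing R] [IsDomain R] (s : Finset ι)
    (l a b r r' : ι → R) {μ ν κ u w d u' w' d' : R} (hμν : μ ≠ ν)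
    (hr : ∀ j, (l j ^ 2 - μ) * r j = 1) (hr' : ∀ j, (l j ^ 2 - ν) * r' j = 1)
    (hu : u = ∑ j ∈ s, l j * a j ^ 2 * r j) (hw : w = ∑ j ∈ s, l j * b j ^ 2 * r j)
    (hd : d = κ + μ * ∑ j ∈ s, a j * b j * r j)
    (hu' : u' = ∑ j ∈ s, l j * a j ^ 2 * r' j) (hw' : w' = ∑ j ∈ s, l j * b j ^ 2 * r' j)
    (hd' : d' = κ + ν * ∑ j ∈ s, a j * b j * r' j) :
    ∑ j ∈ s, (μ * (r j * (d * b j - l j * w * a j)) * (ν * (r' j * (d' * a j - l j * u' * b j))) -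
      μ * (r j * (d * a j - l j * u * b j)) * (ν * (r' j * (d' * b j - l j * w' * a j)))) = 0 := by
  have hrr : ∀ j, (μ - ν) * (r j * r' j) = r j - r' j := fun j => by
    linear_combination r j * hr' j - r' j * hr j
  have hU : (μ - ν) * ∑ j ∈ s, l j * a j ^ 2 * (r j * r' j) = u - u' := by
    rw [hu, hu', ← Finset.sum_sub_distrib, Finset.mul_sum]
    exact Finset.sum_congr rfl fun j _ => by linear_combination l j * a j ^ 2 * hrr j
  have hW : (μ - ν) * ∑ j ∈ s, l j * b j ^ 2 * (r j * r' j) = w - w' := by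
    rw [hw, hw', ← Finset.sum_sub_distrib, Finset.mul_sum]
    exact Finset.sum_congr rfl fun j _ => by linear_combination l j * b j ^ 2 * hrr j
  have hD : (μ - ν) * ∑ j ∈ s, l j ^ 2 * (a j * b j) * (r j * r' j) = d - d' := by
    rw [hd, hd', add_sub_add_left_eq_sub, Finset.mul_sum, Finset.mul_sum, Finset.mul_sum,
      ← Finset.sum_sub_distrib]
    exact Finset.sum_congr rfl fun j _ => by
      linear_combination a j * b j * (l j ^ 2 * hrr j + hr j - hr' j)
  have hsum : ∑ j ∈ s, (μ * (r j * (d * b j - l j * w * a j)) *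
        (ν * (r' j * (d' * a j - l j * u' * b j))) -
      μ * (r j * (d * a j - l j * u * b j)) * (ν * (r' j * (d' * b j - l j * w' * a j)))) =
      μ * ν * ((d' * u - d * u') * ∑ j ∈ s, l j * b j ^ 2 * (r j * r' j) +
        (d * w' - d' * w) * ∑ j ∈ s, l j * a j ^ 2 * (r j * r' j) +
        (w * u' - u * w') * ∑ j ∈ s, l j ^ 2 * (a j * b j) * (r j * r' j)) := by
    simp only [Finset.mul_sum, ← Finset.sum_add_distrib]
    exact Finset.sum_congr rfl fun j _ => by ring
  refine (mul_eq_zero.1 ?_).resolve_left (sub_ne_zero.2 hμν)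
  rw [hsum]
  linear_combination μ * ν * ((d' * u - d * u') * hW + (d * w' - d' * w) * hU +
    (w * u' - u * w') * hD)

/-- The two generating series, in the variables `μ` and `ν`, live in the domain `𝕜⟦μ⟧⟦ν⟧`. -/
theorem poisson_Fm_Fm {lam : Fin N → 𝕜} (hl : ∀ j, lam j ≠ 0) (m n : ℕ) (z : Phase 𝕜 N) :
    poisson (Fm lam (-(m + 1 : ℕ))) (Fm lam (-(n + 1 : ℕ))) z = 0 := by
  let ι₁ : 𝕜⟦X⟧ →+* 𝕜⟦X⟧⟦X⟧ := C
  let ι₂ : 𝕜⟦X⟧ →+* 𝕜⟦X⟧⟦X⟧ := PowerSeries.map C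
  have hcoeff : ∀ f g : 𝕜⟦X⟧, coeff (m + 1) (coeff (n + 1) (ι₁ f * ι₂ g)) =
      coeff (m + 1) f * coeff (n + 1) g := by
    intro f g
    rw [coeff_C_mul, coeff_map, coeff_mul_C]
  have hC : ∀ x : 𝕜, ι₂ (C x) = ι₁ (C x) := fun x => by simp [ι₁, ι₂]
  have hne : ι₁ X ≠ ι₂ X := by
    intro h
    have h0 := congrArg (fun f => coeff 1 (coeff 0 f)) h
    simp [ι₁, ι₂] at h0
  have key := sum_bracket_eq_zero Finset.univ (fun j => ι₁ (C (lam j)))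
    (fun j => ι₁ (C (z.1 j - z.2 j))) (fun j => ι₁ (C (z.1 j + z.2 j)))
    (fun j => ι₁ (res lam j)) (fun j => ι₂ (res lam j)) (κ := ι₁ (C (1 / 4)))
    (u := ι₁ (genU lam z)) (w := ι₁ (genW lam z)) (d := ι₁ (genD lam z))
    (u' := ι₂ (genU lam z)) (w' := ι₂ (genW lam z)) (d' := ι₂ (genD lam z)) hne
    (fun j => by rw [← map_pow, ← map_sub, ← map_mul, sub_mul_res (hl j), map_one])
    (fun j => by rw [← hC, ← map_pow, ← map_sub, ← map_mul, sub_mul_res (hl j), map_one])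
    (by simp only [genU, poleSum, map_sum, map_mul, map_pow])
    (by simp only [genW, poleSum, map_sum, map_mul, map_pow])
    (by simp only [genD, poleSum, map_sum, map_mul, map_add])
    (by simp only [genU, poleSum, map_sum, map_mul, map_pow, hC])
    (by simp only [genW, poleSum, map_sum, map_mul, map_pow, hC])
    (by simp only [genD, poleSum, map_sum, map_mul, map_add, hC])
  have key' : ∑ j, (ι₁ (gradA lam z j) * ι₂ (gradB lam z j) -
      ι₁ (gradB lam z j) * ι₂ (gradA lam z j)) = 0 := by
    rw [← key]
    refine Finset.sum_congr rfl fun j _ => ?_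
    simp only [gradA, gradB, map_mul, map_sub, hC]
  have h0 := congrArg (fun f => coeff (m + 1) (coeff (n + 1) f)) key'
  simp only [map_sum, map_sub, hcoeff, map_zero] at h0
  rw [poisson, dotProduct, dotProduct, ← Finset.sum_sub_distrib]
  simp only [dq_Fm hl, dp_Fm hl]
  rw [← mul_zero (1 / 2 : 𝕜), ← h0, Finset.mul_sum]
  exact Finset.sum_congr rfl fun j _ => by ring

theorem poisson_conF_Fm {lam : Fin N → 𝕜} (hl : ∀ j, lam j ≠ 0) (n : ℕ) (z : Phase 𝕜 N) :
    poisson conF (Fm lam (-(n + 1 : ℕ))) z = 0 := by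
  have key : ∑ j, (C (z.1 j - z.2 j) * gradA lam z j - C (z.1 j + z.2 j) * gradB lam z j) = 0 := by
    have h : ∑ j, (C (z.1 j - z.2 j) * gradA lam z j - C (z.1 j + z.2 j) * gradB lam z j) =
        X * (genW lam z * genU lam z - genU lam z * genW lam z) := by
      conv_rhs =>
        enter [2, 1, 1]
        rw [genW]
      conv_rhs =>
        enter [2, 2, 1]
        rw [genU]
      simp only [poleSum, gradA, gradB, Finset.sum_mul, Finset.mul_sum, ← Finset.sum_sub_distrib]
      refine Finset.sum_congr rfl fun j _ => ?_
      simp only [map_mul, map_pow]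
      ring
    rw [h]; ring
  have h0 := congrArg (coeff (n + 1)) key
  simp only [map_sum, map_sub (coeff (n + 1)), coeff_C_mul, map_zero] at h0
  rw [poisson, dotProduct, dotProduct, ← Finset.sum_sub_distrib]
  simp only [dq_conF, dp_conF, dq_Fm hl, dp_Fm hl]
  rw [← h0]
  exact Finset.sum_congr rfl fun j _ => by ring

/-- On `F = 0` the diagonal entry of the Lax matrix vanishes at infinity. -/
theorem genD_eq {lam : Fin N → 𝕜} (hl : ∀ j, lam j ≠ 0) {z : Phase 𝕜 N} (hz : conF z = 0) :
    genD lam z = poleSum lam fun j => lam j ^ 2 * ((z.1 j - z.2 j) * (z.1 j + z.2 j)) := by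
  have h4 : (1 / 4 : 𝕜) = ∑ j, (z.1 j - z.2 j) * (z.1 j + z.2 j) := by
    have : conF z = ∑ j, (z.1 j - z.2 j) * (z.1 j + z.2 j) - 1 / 4 := by
      rw [conF, dotProduct, dotProduct, ← Finset.sum_sub_distrib]
      congr 1
      exact Finset.sum_congr rfl fun j _ => by ring
    rw [hz] at this
    linear_combination this
  rw [genD, h4, poleSum, poleSum, map_sum, Finset.mul_sum, ← Finset.sum_add_distrib]
  refine Finset.sum_congr rfl fun j _ => ?_
  rw [map_mul C (lam j ^ 2), map_pow]
  linear_combination -C ((z.1 j - z.2 j) * (z.1 j + z.2 j)) * sub_mul_res (hl j)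

theorem poisson_realH_Fm {lam : Fin N → 𝕜} (hl : ∀ j, lam j ≠ 0) (n : ℕ) {z : Phase 𝕜 N}
    (hz : conF z = 0) : poisson (realH lam) (Fm lam (-(n + 1 : ℕ))) z = 0 := by
  have key : ∑ j, (C (lam j * (z.1 j + z.2 j)) * gradA lam z j +
      C (lam j * (z.1 j - z.2 j)) * gradB lam z j) = 0 := by
    have h : ∑ j, (C (lam j * (z.1 j + z.2 j)) * gradA lam z j +
        C (lam j * (z.1 j - z.2 j)) * gradB lam z j) =
        X * (genD lam z * genW lam z + genD lam z * genU lam z -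
          (genU lam z + genW lam z) * genD lam z) := by
      conv_rhs =>
        enter [2, 2]
        rw [genD_eq hl hz]
      conv_rhs =>
        enter [2, 1]
        rw [genU, genW]
      simp only [poleSum, gradA, gradB, Finset.mul_sum, ← Finset.sum_sub_distrib,
        ← Finset.sum_add_distrib]
      refine Finset.sum_congr rfl fun j _ => ?_
      simp only [map_mul, map_pow]
      ring
    rw [h]; ring
  have h0 := congrArg (coeff (n + 1)) key
  simp only [map_sum, map_add, coeff_C_mul, map_zero] at h0
  rw [poisson, dotProduct, dotProduct, ← Finset.sum_sub_distrib]
  simp only [dq_realH, dp_realH, dq_Fm hl, dp_Fm hl]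
  rw [← mul_zero (1 / 2 : 𝕜), ← h0, Finset.mul_sum]
  exact Finset.sum_congr rfl fun j _ => by ring

theorem dirac_Fm_Fm {lam : Fin N → 𝕜} (hl : ∀ j, lam j ≠ 0) {m n : ℤ} (hm : m < 0) (hn : n < 0)
    (z : Phase 𝕜 N) : dirac lam (Fm lam m) (Fm lam n) z = 0 := by
  obtain ⟨m, rfl⟩ : ∃ k : ℕ, m = -(k + 1 : ℕ) := ⟨(-m - 1).toNat, by omega⟩
  obtain ⟨n, rfl⟩ : ∃ k : ℕ, n = -(k + 1 : ℕ) := ⟨(-n - 1).toNat, by omega⟩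
  rw [dirac, poisson_Fm_Fm hl, poisson_swap _ conF, poisson_conF_Fm hl, poisson_conF_Fm hl]
  ring

theorem dirac_realH_Fm {lam : Fin N → 𝕜} (hl : ∀ j, lam j ≠ 0) {m : ℤ} (hm : m < 0)
    {z : Phase 𝕜 N} (hz : z ∈ M lam) : dirac lam (realH lam) (Fm lam m) z = 0 := by
  obtain ⟨m, rfl⟩ : ∃ k : ℕ, m = -(k + 1 : ℕ) := ⟨(-m - 1).toNat, by omega⟩
  rw [dirac, poisson_realH_Fm hl _ hz.1, poisson_swap _ conF, poisson_conF_realH hz.2.1,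
    poisson_conF_Fm hl]
  ring

end

/-! ### Sums of simple fractions as polynomials over a common denominator -/

section
open Polynomial

variable {𝕜 : Type*} [Field 𝕜] {N : ℕ}

open Classical in
/-- The set of the distinct values among the `λ_j²`; two of them coincide when `λ_k = -λ_j`. -/
noncomputable def nodes (lam : Fin N → 𝕜) : Finset 𝕜 := Finset.univ.image fun j => lam j ^ 2

open Classical in
/-- `∏ (X - x)` over the nodes `x ≠ λ_j²`. -/
noncomputable def cofactor (lam : Fin N → 𝕜) (j : Fin N) : 𝕜[X] :=
  ∏ x ∈ (nodes lam).erase (lam j ^ 2), (X - C x)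

/-- The numerator of `∑ c_j / (X - λ_j²)` over the reduced denominator `∏ (X - x)`, `x` ranging over
the nodes. -/
noncomputable def numer (lam c : Fin N → 𝕜) : 𝕜[X] := ∑ j, C (c j) * cofactor lam j

theorem mem_nodes (lam : Fin N → 𝕜) (j : Fin N) : lam j ^ 2 ∈ nodes lam := by
  classical
  exact Finset.mem_image_of_mem _ (Finset.mem_univ j)

theorem monic_cofactor (lam : Fin N → 𝕜) (j : Fin N) : (cofactor lam j).Monic :=
  monic_prod_X_sub_C _ _

theorem natDegree_cofactor (lam : Fin N → 𝕜) (j : Fin N) :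
    (cofactor lam j).natDegree = (nodes lam).card - 1 := by
  classical
  rw [cofactor, natDegree_finsetProd_X_sub_C_eq_card, Finset.card_erase_of_mem (mem_nodes lam j)]

theorem coeff_cofactor_of_le (lam : Fin N → 𝕜) (j : Fin N) {n : ℕ} (h : (nodes lam).card ≤ n) :
    (cofactor lam j).coeff n = 0 := by
  refine coeff_eq_zero_of_natDegree_lt ?_
  have := Finset.card_pos.2 ⟨_, mem_nodes lam j⟩
  rw [natDegree_cofactor]; omega

theorem coeff_numer_of_le (lam c : Fin N → 𝕜) {n : ℕ} (h : (nodes lam).card ≤ n) :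
    (numer lam c).coeff n = 0 := by
  rw [numer, finsetSum_coeff]
  exact Finset.sum_eq_zero fun j _ => by rw [coeff_C_mul, coeff_cofactor_of_le lam j h, mul_zero]

theorem coeff_numer_top (lam c : Fin N → 𝕜) :
    (numer lam c).coeff ((nodes lam).card - 1) = ∑ j, c j := by
  rw [numer, finsetSum_coeff]
  refine Finset.sum_congr rfl fun j _ => ?_
  rw [coeff_C_mul, ← natDegree_cofactor lam j, (monic_cofactor lam j).coeff_natDegree, mul_one]

theorem eval_cofactor_self (lam : Fin N → 𝕜) (j : Fin N) :
    (cofactor lam j).eval (lam j ^ 2) ≠ 0 := by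
  classical
  rw [cofactor, eval_prod, Finset.prod_ne_zero_iff]
  intro x hx
  rw [eval_sub, eval_X, eval_C, sub_ne_zero]
  exact (Finset.ne_of_mem_erase hx).symm

theorem eval_cofactor_of_ne {lam : Fin N → 𝕜} {i j : Fin N} (h : lam i ^ 2 ≠ lam j ^ 2) :
    (cofactor lam j).eval (lam i ^ 2) = 0 := by
  classical
  rw [cofactor, eval_prod]
  exact Finset.prod_eq_zero (Finset.mem_erase.2 ⟨h, mem_nodes lam i⟩) (by simp)

open Classical in
theorem eval_numer (lam c : Fin N → 𝕜) (i : Fin N) :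
    (numer lam c).eval (lam i ^ 2) =
      (∑ j with lam j ^ 2 = lam i ^ 2, c j) * (cofactor lam i).eval (lam i ^ 2) := by
  rw [numer, eval_finsetSum, Finset.sum_filter, Finset.sum_mul]
  refine Finset.sum_congr rfl fun j _ => ?_
  rw [eval_mul, eval_C]
  split_ifs with h
  · rw [cofactor, cofactor, h]
  · rw [eval_cofactor_of_ne (Ne.symm h), mul_zero, zero_mul]

theorem coe_finset_sum {ι : Type*} (s : Finset ι) (f : ι → 𝕜[X]) :
    ((∑ i ∈ s, f i : 𝕜[X]) : PowerSeries 𝕜) = ∑ i ∈ s, (f i : PowerSeries 𝕜) :=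
  map_sum (coeToPowerSeries.ringHom (R := 𝕜)) f s

theorem coe_X_sub_C_mul_res {lam : Fin N → 𝕜} {j : Fin N} (h : lam j ≠ 0) :
    ((X - C (lam j ^ 2) : 𝕜[X]) : PowerSeries 𝕜) * res lam j = -1 := by
  rw [coe_sub, coe_X, coe_C, map_pow, ← sub_mul_res h]; ring

/-- Clearing the denominators of a sum of simple fractions. -/
theorem coe_prod_nodes_mul_poleSum {lam : Fin N → 𝕜} (hl : ∀ j, lam j ≠ 0) (c : Fin N → 𝕜) :
    ((∏ x ∈ nodes lam, (X - C x) : 𝕜[X]) : PowerSeries 𝕜) * poleSum lam c =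
      -(numer lam c : PowerSeries 𝕜) := by
  classical
  rw [poleSum, numer, Finset.mul_sum, coe_finset_sum,
    ← Finset.sum_neg_distrib]
  refine Finset.sum_congr rfl fun j _ => ?_
  rw [coe_mul, coe_C, ← Finset.mul_prod_erase _ _ (mem_nodes lam j),
    coe_mul, cofactor]
  linear_combination (PowerSeries.C (c j) *
    ((∏ x ∈ (nodes lam).erase (lam j ^ 2), (X - C x) : 𝕜[X]) : PowerSeries 𝕜)) *
      coe_X_sub_C_mul_res (hl j)

open Classical in
theorem coe_prod_mul_res_mul_res {lam : Fin N → 𝕜} (hl : ∀ j, lam j ≠ 0) {j k : Fin N}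
    (hjk : k ≠ j) :
    ((∏ i, (X - C (lam i ^ 2)) : 𝕜[X]) : PowerSeries 𝕜) * (res lam j * res lam k) =
      ((∏ i ∈ (Finset.univ.erase j).erase k, (X - C (lam i ^ 2)) : 𝕜[X]) : PowerSeries 𝕜) := by
  rw [← Finset.mul_prod_erase _ _ (Finset.mem_univ j),
    ← Finset.mul_prod_erase (Finset.univ.erase j) _ (Finset.mem_erase.2 ⟨hjk, Finset.mem_univ k⟩),
    coe_mul, coe_mul]
  have h1 := coe_X_sub_C_mul_res (hl j)
  have h2 := coe_X_sub_C_mul_res (hl k)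
  linear_combination ((∏ i ∈ (Finset.univ.erase j).erase k, (X - C (lam i ^ 2)) : 𝕜[X]) :
    PowerSeries 𝕜) * (((X - C (lam k ^ 2) : 𝕜[X]) : PowerSeries 𝕜) * res lam k * h1 - h2)

/-! ### Independence at generic points -/

/-- The generic points: the numerators of the entries `u` and `d` of the Lax matrix are coprime, that
of `u` has full degree, and `a_j b_k + a_k b_j ≠ 0`. The last condition matters only for `k = j` (a
simple pole of the Lax matrix) and for `λ_k = -λ_j` (a pole common to two indices). -/
structure IsGeneric (lam : Fin N → 𝕜) (z : Phase 𝕜 N) : Prop where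
  sum_ne_zero : ∑ j, lam j * (z.1 j - z.2 j) ^ 2 ≠ 0
  pair_ne_zero : ∀ j k, (z.1 j - z.2 j) * (z.1 k + z.2 k) + (z.1 k - z.2 k) * (z.1 j + z.2 j) ≠ 0
  isCoprime : IsCoprime (numer lam fun j => lam j * (z.1 j - z.2 j) ^ 2)
    (numer lam fun j => lam j ^ 2 * ((z.1 j - z.2 j) * (z.1 j + z.2 j)))

/-- A combination of the products `1 / ((λ_j² - X) (λ_k² - X))` with `j ≠ k` is a polynomial of degree
at most `N - 2` divided by `∏ (X - λ_i²)`; so it is zero if it vanishes to the order `N - 1`. -/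
theorem sum_res_mul_res_eq_zero {lam : Fin N → 𝕜} (hl : ∀ j, lam j ≠ 0) (c : Fin N → Fin N → 𝕜)
    (hc : ∀ j, c j j = 0)
    (h : ∀ n < N - 1, PowerSeries.coeff n
      (∑ j, ∑ k, PowerSeries.C (c j k) * (res lam j * res lam k)) = 0) :
    ∑ j, ∑ k, PowerSeries.C (c j k) * (res lam j * res lam k) = 0 := by
  classical
  set f := ∑ j, ∑ k, PowerSeries.C (c j k) * (res lam j * res lam k) with hf
  let Q : 𝕜[X] := ∑ j, ∑ k, C (c j k) * ∏ i ∈ (Finset.univ.erase j).erase k, (X - C (lam i ^ 2))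
  have hQ : ((∏ i, (X - C (lam i ^ 2)) : 𝕜[X]) : PowerSeries 𝕜) * f = (Q : PowerSeries 𝕜) := by
    rw [hf]
    simp only [Q, coe_finset_sum, Finset.mul_sum]
    refine Finset.sum_congr rfl fun j _ => Finset.sum_congr rfl fun k _ => ?_
    rw [coe_mul, coe_C]
    by_cases hjk : k = j
    · rw [hjk, hc]; simp
    · rw [← coe_prod_mul_res_mul_res hl hjk]; ring
  have hQ0 : Q = 0 := by
    ext n
    rw [coeff_zero]
    rcases lt_or_ge n (N - 1) with hn | hn
    · have hd : (PowerSeries.X : PowerSeries 𝕜) ^ (N - 1) ∣ (Q : PowerSeries 𝕜) := by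
        rw [← hQ]
        exact Dvd.dvd.mul_left (PowerSeries.X_pow_dvd_iff.2 h) _
      rw [← coeff_coe]
      exact PowerSeries.X_pow_dvd_iff.1 hd n hn
    · simp only [Q, finsetSum_coeff, coeff_C_mul]
      refine Finset.sum_eq_zero fun j _ => Finset.sum_eq_zero fun k _ => ?_
      by_cases hjk : k = j
      · rw [hjk, hc, zero_mul]
      · rw [coeff_eq_zero_of_natDegree_lt, mul_zero]
        have h2 : ({k, j} : Finset (Fin N)).card ≤ N := by
          simpa using Finset.card_le_univ ({k, j} : Finset (Fin N))
        rw [Finset.card_pair hjk] at h2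
        rw [natDegree_prod_of_monic _ _ fun i _ => monic_X_sub_C _]
        simp only [natDegree_X_sub_C, Finset.sum_const, smul_eq_mul, mul_one]
        rw [Finset.card_erase_of_mem (Finset.mem_erase.2 ⟨hjk, Finset.mem_univ k⟩),
          Finset.card_erase_of_mem (Finset.mem_univ j), Finset.card_univ, Fintype.card_fin]
        omega
  rw [hQ0, coe_zero] at hQ
  refine (mul_eq_zero.1 hQ).resolve_left ?_
  rw [coe_eq_zero_iff]
  exact (monic_prod_X_sub_C _ _).ne_zero

end

section
open PowerSeries

variable {𝕜 : Type*} [NontriviallyNormedField 𝕜] [CharZero 𝕜] {N : ℕ}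

/-- At a generic point, a variation `β` of `b = q + p` along which `F` and `F_{-1}, …, F_{-(N-1)}`
are stationary is trivial. Stationarity says that `D A = U B` for polynomials `A`, `B` which are
linear in `β`, with `deg A < deg U`; so `U ∣ A`, and `A = B = 0`. -/
theorem IsGeneric.eq_zero {lam : Fin N → 𝕜} (hinj : Function.Injective lam) (hl : ∀ j, lam j ≠ 0)
    {z : Phase 𝕜 N} (hz : conF z = 0) (hg : IsGeneric lam z) {β : Fin N → 𝕜}
    (hβ : ∑ j, β j * (z.1 j - z.2 j) = 0)
    (h : ∀ n < N - 1, ∑ j, coeff (n + 1) (gradB lam z j) * β j = 0) : β = 0 := by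
  classical
  set a : Fin N → 𝕜 := fun j => z.1 j - z.2 j with ha
  set b : Fin N → 𝕜 := fun j => z.1 j + z.2 j with hb
  set U := numer lam fun j => lam j * a j ^ 2 with hU
  set D := numer lam fun j => lam j ^ 2 * (a j * b j) with hD
  set A := numer lam fun j => β j * a j with hA
  set B := numer lam fun j => β j * (lam j * b j) with hB
  -- The stationarity series, without its factor `X`.
  have hf : genD lam z * poleSum lam (fun j => β j * a j) -
      genU lam z * poleSum lam (fun j => β j * (lam j * b j)) = 0 := by
    have e1 : genD lam z * poleSum lam (fun j => β j * a j) -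
        genU lam z * poleSum lam (fun j => β j * (lam j * b j)) =
        ∑ j, ∑ k, C (β j * (lam k * a k) * (lam k * a j * b k - lam j * a k * b j)) *
          (res lam j * res lam k) := by
      rw [genD_eq hl hz, genU]
      simp only [poleSum, Finset.mul_sum, Finset.sum_mul, ← Finset.sum_sub_distrib]
      refine Finset.sum_congr rfl fun j _ => Finset.sum_congr rfl fun k _ => ?_
      simp only [map_mul, map_sub, map_pow, ha, hb]
      ring
    have e2 : X * (genD lam z * poleSum lam (fun j => β j * a j) -
        genU lam z * poleSum lam (fun j => β j * (lam j * b j))) =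
        ∑ j, gradB lam z j * C (β j) := by
      simp only [poleSum, gradB, Finset.mul_sum, ← Finset.sum_sub_distrib]
      refine Finset.sum_congr rfl fun j _ => ?_
      simp only [map_mul, ha, hb]
      ring
    rw [e1]
    refine sum_res_mul_res_eq_zero hl _ (fun j => by ring) fun n hn => ?_
    rw [← e1, ← coeff_succ_X_mul, e2, map_sum]
    simpa only [coeff_mul_C] using h n hn
  have hmul : D * A = U * B := by
    apply Polynomial.coe_injective
    rw [Polynomial.coe_mul, Polynomial.coe_mul]
    have p1 := coe_prod_nodes_mul_poleSum hl fun j => lam j * a j ^ 2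
    have p2 := coe_prod_nodes_mul_poleSum hl fun j => lam j ^ 2 * (a j * b j)
    have p3 := coe_prod_nodes_mul_poleSum hl fun j => β j * a j
    have p4 := coe_prod_nodes_mul_poleSum hl fun j => β j * (lam j * b j)
    rw [genD_eq hl hz, genU] at hf
    rw [← neg_mul_neg (D : 𝕜⟦X⟧), ← neg_mul_neg (U : 𝕜⟦X⟧), hU, hD, hA, hB, ← p1, ← p2, ← p3, ← p4]
    linear_combination
      ((∏ x ∈ nodes lam, (Polynomial.X - Polynomial.C x) : Polynomial 𝕜) : 𝕜⟦X⟧) ^ 2 * hf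
  have hUtop : U.coeff ((nodes lam).card - 1) ≠ 0 := by
    rw [hU, coeff_numer_top]; exact hg.sum_ne_zero
  have hU0 : U ≠ 0 := fun h0 => hUtop (by rw [h0, Polynomial.coeff_zero])
  have hA0 : A = 0 := by
    have hdvd : U ∣ A := hg.isCoprime.dvd_of_dvd_mul_left ⟨B, hmul⟩
    refine Polynomial.eq_zero_of_dvd_of_degree_lt hdvd ?_
    refine lt_of_lt_of_le ?_ (Polynomial.le_degree_of_ne_zero hUtop)
    rw [Polynomial.degree_lt_iff_coeff_zero]
    intro n hn
    rcases hn.eq_or_lt with rfl | hn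
    · rw [hA, coeff_numer_top, hβ]
    · exact coeff_numer_of_le lam _ (by omega)
  have hB0 : B = 0 := by
    rw [hA0, mul_zero] at hmul
    exact (mul_eq_zero.1 hmul.symm).resolve_left hU0
  ext i
  have hAi : ∑ j with lam j ^ 2 = lam i ^ 2, β j * a j = 0 := by
    have h0 := eval_numer lam (fun j => β j * a j) i
    rw [← hA, hA0, Polynomial.eval_zero] at h0
    exact (mul_eq_zero.1 h0.symm).resolve_right (eval_cofactor_self lam i)
  have hBi : ∑ j with lam j ^ 2 = lam i ^ 2, β j * (lam j * b j) = 0 := by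
    have h0 := eval_numer lam (fun j => β j * (lam j * b j)) i
    rw [← hB, hB0, Polynomial.eval_zero] at h0
    exact (mul_eq_zero.1 h0.symm).resolve_right (eval_cofactor_self lam i)
  by_cases hk : ∃ k, k ≠ i ∧ lam k ^ 2 = lam i ^ 2
  · obtain ⟨k, hki, hk⟩ := hk
    have hneg : lam k = -lam i := (sq_eq_sq_iff_eq_or_eq_neg.1 hk).resolve_left fun h => hki (hinj h)
    have hfil : (Finset.univ.filter fun j => lam j ^ 2 = lam i ^ 2) = {i, k} := by
      ext j
      simp only [Finset.mem_filter, Finset.mem_univ, true_and, Finset.mem_insert,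
        Finset.mem_singleton]
      constructor
      · intro hj
        rcases sq_eq_sq_iff_eq_or_eq_neg.1 hj with h1 | h1
        · exact Or.inl (hinj h1)
        · exact Or.inr (hinj (h1.trans hneg.symm))
      · rintro (rfl | rfl)
        · rfl
        · exact hk
    rw [hfil, Finset.sum_pair hki.symm] at hAi hBi
    rw [hneg] at hBi
    have hBi' : β i * b i - β k * b k = 0 :=
      (mul_eq_zero.1 (show lam i * (β i * b i - β k * b k) = 0 by
        linear_combination hBi)).resolve_left (hl i)
    have hp := hg.pair_ne_zero i k
    refine (mul_eq_zero.1 (?_ : β i * (a i * b k + a k * b i) = 0)).resolve_right hp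
    linear_combination b k * hAi + a k * hBi'
  · have hfil : (Finset.univ.filter fun j => lam j ^ 2 = lam i ^ 2) = {i} := by
      ext j
      simp only [Finset.mem_filter, Finset.mem_univ, true_and, Finset.mem_singleton]
      refine ⟨fun hj => ?_, fun hj => by rw [hj]⟩
      by_contra hne
      exact hk ⟨j, hne, hj⟩
    rw [hfil, Finset.sum_singleton] at hAi
    refine (mul_eq_zero.1 hAi).resolve_right fun h0 => hg.pair_ne_zero i i ?_
    change a i * b i + a i * b i = 0
    rw [h0]; ring

end

/-! ### Density of the generic points -/

section
open Polynomial Filter Topology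

variable {𝕜 : Type*} [NontriviallyNormedField 𝕜] [CompleteSpace 𝕜] {N : ℕ}

theorem dense_forall_notMem {ι : Type*} [Finite ι] (W : ι → Submodule 𝕜 (Fin N → 𝕜))
    (hW : ∀ i, W i ≠ ⊤) : Dense {x | ∀ i, x ∉ W i} := by
  have h : Dense (⋂ i, ((W i : Set (Fin N → 𝕜))ᶜ)) := by
    refine dense_iInter_of_isOpen (fun i => ?_) fun i => ?_
    · exact (Submodule.closed_of_finiteDimensional (W i)).isOpen_compl
    · refine interior_eq_empty_iff_dense_compl.1 (Set.not_nonempty_iff_eq_empty.1 fun hne => hW i ?_)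
      exact Submodule.eq_top_of_nonempty_interior' (W i) hne
  refine h.mono fun x hx i => ?_
  simpa using Set.mem_iInter.1 hx i

omit [CompleteSpace 𝕜] in
theorem numer_mul_left (lam c : Fin N → 𝕜) (t : 𝕜) :
    numer lam (fun j => t * c j) = C t * numer lam c := by
  simp only [numer, Finset.mul_sum, map_mul, mul_assoc]

omit [CompleteSpace 𝕜] in
theorem numer_single (lam : Fin N → 𝕜) (c : Fin N → 𝕜) (j : Fin N) :
    numer lam (fun k => c k * (Pi.single j 1 : Fin N → 𝕜) k) = C (c j) * cofactor lam j := by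
  rw [numer, Finset.sum_eq_single j]
  · simp
  · intro k _ hk; simp [hk]
  · simp

omit [CompleteSpace 𝕜] in
/-- An irreducible polynomial cannot divide all the cofactors. -/
theorem exists_not_dvd_cofactor (lam : Fin N → 𝕜) (j₀ : Fin N) {π : 𝕜[X]} (hπ : Irreducible π) :
    ∃ j, ¬π ∣ cofactor lam j := by
  classical
  by_contra! hall
  obtain ⟨x, hx, hdvd⟩ := (hπ.prime.dvd_finsetProd_iff _).1 (hall j₀)
  obtain ⟨k, -, hk⟩ := Finset.mem_image.1 (Finset.mem_of_mem_erase hx)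
  have hassoc : Associated π (X - C x) := (hπ.associated_of_dvd (irreducible_X_sub_C x) hdvd)
  have h1 : X - C x ∣ cofactor lam k := hassoc.symm.dvd.trans (hall k)
  rw [dvd_iff_isRoot, IsRoot.def, ← hk] at h1
  exact eval_cofactor_self lam k h1

variable [CharZero 𝕜]

/-- For fixed `a = q - p`, all but finitely many proper subspaces of values of `b = q + p` give
generic points. -/
theorem dense_generic {lam : Fin N → 𝕜} (hl : ∀ j, lam j ≠ 0) {a : Fin N → 𝕜} (ha : ∀ j, a j ≠ 0)
    (hA : ∑ j, lam j * a j ^ 2 ≠ 0) :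
    Dense {b : Fin N → 𝕜 | (∀ j k, a j * b k + a k * b j ≠ 0) ∧
      IsCoprime (numer lam fun j => lam j * a j ^ 2)
        (numer lam fun j => lam j ^ 2 * (a j * b j))} := by
  classical
  obtain ⟨j₀⟩ : Nonempty (Fin N) := by
    by_contra h
    rw [not_nonempty_iff] at h
    exact hA (by simp)
  set U := numer lam fun j => lam j * a j ^ 2 with hU
  have hU0 : U ≠ 0 := fun h0 => hA (by rw [← coeff_numer_top, ← hU, h0, coeff_zero])
  let P : Fin N × Fin N → Submodule 𝕜 (Fin N → 𝕜) := fun i =>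
    { carrier := {b | a i.1 * b i.2 + a i.2 * b i.1 = 0}
      zero_mem' := by simp
      add_mem' := fun {b c} hb hc => by
        simp only [Set.mem_ofPred_eq, Pi.add_apply] at *
        linear_combination hb + hc
      smul_mem' := fun t b hb => by
        simp only [Set.mem_ofPred_eq, Pi.smul_apply, smul_eq_mul] at *
        linear_combination t * hb }
  let Q : 𝕜[X] → Submodule 𝕜 (Fin N → 𝕜) := fun π =>
    { carrier := {b | π ∣ numer lam fun j => lam j ^ 2 * (a j * b j)}
      zero_mem' := by simp [numer]
      add_mem' := fun {b c} hb hc => by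
        have : (numer lam fun j => lam j ^ 2 * (a j * (b + c) j)) =
            (numer lam fun j => lam j ^ 2 * (a j * b j)) +
              numer lam fun j => lam j ^ 2 * (a j * c j) := by
          simp only [numer, ← Finset.sum_add_distrib, Pi.add_apply, mul_add, map_add, add_mul]
        simp only [Set.mem_ofPred_eq] at hb hc ⊢
        rw [this]
        exact dvd_add hb hc
      smul_mem' := fun t b hb => by
        have : (numer lam fun j => lam j ^ 2 * (a j * (t • b) j)) =
            C t * numer lam fun j => lam j ^ 2 * (a j * b j) := by
          rw [← numer_mul_left]
          congr 1
          funext j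
          rw [Pi.smul_apply, smul_eq_mul]; ring
        simp only [Set.mem_ofPred_eq] at hb ⊢
        rw [this]
        exact hb.mul_left _ }
  let S := (UniqueFactorizationMonoid.normalizedFactors U).toFinset
  have hP : ∀ i, P i ≠ ⊤ := by
    intro i h
    have h1 : (Pi.single i.2 1 : Fin N → 𝕜) ∈ P i := h ▸ Submodule.mem_top
    have h2 : a i.1 * (Pi.single i.2 1 : Fin N → 𝕜) i.2 +
      a i.2 * (Pi.single i.2 1 : Fin N → 𝕜) i.1 = 0 := h1
    by_cases hi : i.1 = i.2
    · rw [hi] at h2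
      simp only [Pi.single_eq_same, mul_one, ← two_mul] at h2
      exact ha i.2 ((mul_eq_zero.1 h2).resolve_left two_ne_zero)
    · rw [Pi.single_eq_of_ne hi] at h2
      simp only [Pi.single_eq_same, mul_one, mul_zero, add_zero] at h2
      exact ha i.1 h2
  have hQ : ∀ π : S, Q π ≠ ⊤ := by
    rintro ⟨π, hπ⟩ h
    have hirr : Irreducible π :=
      UniqueFactorizationMonoid.irreducible_of_normalized_factor π (Multiset.mem_toFinset.1 hπ)
    obtain ⟨j, hj⟩ := exists_not_dvd_cofactor lam j₀ hirr
    have h1 : (Pi.single j 1 : Fin N → 𝕜) ∈ Q π := h ▸ Submodule.mem_top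
    have h2 : π ∣ numer lam fun k => lam k ^ 2 * (a k * (Pi.single j 1 : Fin N → 𝕜) k) := h1
    simp only [← mul_assoc] at h2
    rw [numer_single lam (fun k => lam k ^ 2 * a k)] at h2
    have hu : IsUnit (C (lam j ^ 2 * a j)) :=
      isUnit_C.2 (isUnit_iff_ne_zero.2 (mul_ne_zero (pow_ne_zero 2 (hl j)) (ha j)))
    exact hj (hu.dvd_mul_left.1 h2)
  refine (dense_forall_notMem (Sum.elim P fun π : S => Q π) ?_).mono ?_
  · rintro (i | π)
    exacts [hP i, hQ π]
  · intro b hb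
    refine ⟨fun j k => hb (Sum.inl (j, k)), isCoprime_of_prime_dvd (fun h => hU0 h.1) ?_⟩
    intro π hπ hπU hπD
    obtain ⟨ρ, hρ, hassoc⟩ :=
      UniqueFactorizationMonoid.exists_mem_normalizedFactors_of_dvd hU0 hπ.irreducible hπU
    exact hb (Sum.inr ⟨ρ, Multiset.mem_toFinset.2 hρ⟩) (hassoc.symm.dvd.trans hπD)

/-- The point with `q - p = a` and `q + p = b`. -/
noncomputable def ofDiffSum (a b : Fin N → 𝕜) : Phase 𝕜 N :=
  (fun j => (b j + a j) / 2, fun j => (b j - a j) / 2)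

omit [CompleteSpace 𝕜] in
theorem ofDiffSum_sub (a b : Fin N → 𝕜) (j : Fin N) :
    (ofDiffSum a b).1 j - (ofDiffSum a b).2 j = a j := by
  simp only [ofDiffSum]; ring

omit [CompleteSpace 𝕜] in
theorem ofDiffSum_add (a b : Fin N → 𝕜) (j : Fin N) :
    (ofDiffSum a b).1 j + (ofDiffSum a b).2 j = b j := by
  simp only [ofDiffSum]; ring

omit [CompleteSpace 𝕜] in
theorem mem_M_iff {lam : Fin N → 𝕜} {z : Phase 𝕜 N} : z ∈ M lam ↔
    ∑ j, (z.1 j - z.2 j) * (z.1 j + z.2 j) = 1 / 4 ∧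
    ∑ j, lam j * (z.1 j + z.2 j) ^ 2 = -∑ j, lam j * (z.1 j - z.2 j) ^ 2 ∧
    ∑ j, lam j * (z.1 j - z.2 j) ^ 2 ≠ 0 := by
  have h1 : conF z = ∑ j, (z.1 j - z.2 j) * (z.1 j + z.2 j) - 1 / 4 := by
    rw [conF, dotProduct, dotProduct, ← Finset.sum_sub_distrib]
    congr 1
    exact Finset.sum_congr rfl fun j _ => by ring
  have h2 : conG lam z =
      (∑ j, lam j * (z.1 j + z.2 j) ^ 2 + ∑ j, lam j * (z.1 j - z.2 j) ^ 2) / 4 := by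
    simp only [conG, Lam, zpow_one, dotProduct, ← Finset.sum_add_distrib, Finset.sum_div]
    exact Finset.sum_congr rfl fun j _ => by ring
  have h3 : Lam lam 1 z.1 ⬝ᵥ z.2 =
      (∑ j, lam j * (z.1 j + z.2 j) ^ 2 - ∑ j, lam j * (z.1 j - z.2 j) ^ 2) / 4 := by
    simp only [Lam, zpow_one, dotProduct, ← Finset.sum_sub_distrib, Finset.sum_div]
    exact Finset.sum_congr rfl fun j _ => by ring
  rw [M, Set.mem_ofPred_eq, h1, h2, h3]
  set A := ∑ j, lam j * (z.1 j - z.2 j) ^ 2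
  set B := ∑ j, lam j * (z.1 j + z.2 j) ^ 2
  constructor
  · rintro ⟨e1, e2, e3⟩
    have e2' : B = -A := by linear_combination 4 * e2
    refine ⟨by linear_combination e1, e2', fun h => e3 ?_⟩
    rw [e2', h]; simp
  · rintro ⟨e1, e2, e3⟩
    refine ⟨by rw [e1]; ring, by rw [e2]; ring, fun h => e3 ?_⟩
    rw [e2] at h
    linear_combination -2 * h

/-- Every point of `M` is a limit of generic points of `M`: a generic perturbation `(a, b)` in the
full phase space is brought back to `M` by rescaling `a` and `b`, which preserves genericity. -/
theorem exists_isGeneric_mem {lam : Fin N → 𝕜} (hl : ∀ j, lam j ≠ 0) {z : Phase 𝕜 N}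
    (hz : z ∈ M lam) {V : Set (Phase 𝕜 N)} (hV : V ∈ 𝓝 z) :
    ∃ z' ∈ V, z' ∈ M lam ∧ IsGeneric lam z' := by
  obtain ⟨hE, hBA, hA⟩ := mem_M_iff.1 hz
  set a₀ : Fin N → 𝕜 := fun j => z.1 j - z.2 j with ha₀
  set b₀ : Fin N → 𝕜 := fun j => z.1 j + z.2 j with hb₀
  let A : (Fin N → 𝕜) → 𝕜 := fun a => ∑ j, lam j * a j ^ 2
  let E : (Fin N → 𝕜) × (Fin N → 𝕜) → 𝕜 := fun x => ∑ j, x.1 j * x.2 j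
  have hAc : Continuous A := by fun_prop
  have hEc : Continuous E := by fun_prop
  have hE₀ : E (a₀, b₀) = 1 / 4 := hE
  have hA₀ : A a₀ ≠ 0 := hA
  have hB₀ : A b₀ = -A a₀ := hBA
  -- The rescaled point lies on `M` exactly when `α ^ 4 = g (a, b)`.
  let Θ : 𝕜 × (Fin N → 𝕜) × (Fin N → 𝕜) → Phase 𝕜 N := fun x =>
    ofDiffSum (fun j => x.1 * x.2.1 j) fun j => (4 * x.1 * E x.2)⁻¹ * x.2.2 j
  let g : (Fin N → 𝕜) × (Fin N → 𝕜) → 𝕜 := fun x => -A x.2 / (16 * E x ^ 2 * A x.1)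
  have hΘ₀ : Θ (1, a₀, b₀) = z := by
    simp only [Θ, hE₀]
    ext j
    · simp only [ofDiffSum, ha₀, hb₀]; norm_num
    · simp only [ofDiffSum, ha₀, hb₀]; norm_num
  have hg₀ : g (a₀, b₀) = 1 := by
    simp only [g, hE₀, hB₀]
    field_simp
    norm_num
  have hΘc : ContinuousAt Θ (1, a₀, b₀) := by
    have hinv : ContinuousAt (fun x : 𝕜 × (Fin N → 𝕜) × (Fin N → 𝕜) => (4 * x.1 * E x.2)⁻¹)
        (1, a₀, b₀) := by
      refine ContinuousAt.inv₀ (by fun_prop) ?_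
      simp [hE₀]
    refine ContinuousAt.prodMk ?_ ?_
    · refine continuousAt_pi.2 fun j => ?_
      exact ((hinv.mul (by fun_prop)).add (by fun_prop)).div_const 2
    · refine continuousAt_pi.2 fun j => ?_
      exact ((hinv.mul (by fun_prop)).sub (by fun_prop)).div_const 2
  have hgc : ContinuousAt g (a₀, b₀) := by
    refine ContinuousAt.div (by fun_prop) (by fun_prop) ?_
    rw [hE₀]
    exact mul_ne_zero (by norm_num) hA₀
  have hΘV : Θ ⁻¹' V ∈ 𝓝 ((1 : 𝕜), (a₀, b₀)) := hΘc (by rwa [hΘ₀])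
  obtain ⟨S, hS, T, hT, hST⟩ := mem_nhds_prod_iff.1 hΘV
  have hS' : (fun α : 𝕜 => α ^ 4) '' (S ∩ {0}ᶜ) ∈ 𝓝 (1 : 𝕜) := by
    have h4 := (hasStrictDerivAt_pow 4 (1 : 𝕜)).map_nhds_eq (by norm_num)
    rw [one_pow] at h4
    rw [← h4]
    exact image_mem_map (inter_mem hS (isOpen_compl_singleton.mem_nhds one_ne_zero))
  have hnear : ∀ᶠ x in 𝓝 (a₀, b₀), x ∈ T ∧ g x ∈ (fun α : 𝕜 => α ^ 4) '' (S ∩ {0}ᶜ) ∧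
      A x.1 ≠ 0 ∧ E x ≠ 0 := by
    have c1 : ContinuousAt (fun x : (Fin N → 𝕜) × (Fin N → 𝕜) => A x.1) (a₀, b₀) := by fun_prop
    refine (eventually_mem_set.2 hT).and ((hgc.eventually_mem (by rwa [hg₀])).and
      ((c1.eventually_ne hA₀).and (hEc.continuousAt.eventually_ne ?_)))
    rw [hE₀]; norm_num
  obtain ⟨Ta, hTa, Tb, hTb, hTab⟩ := mem_nhds_prod_iff.1 hnear
  have hdense := dense_forall_notMem (fun j : Fin N =>
    LinearMap.ker (LinearMap.proj (R := 𝕜) (φ := fun _ : Fin N => 𝕜) j)) fun j h => by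
      have h1 : (Pi.single j 1 : Fin N → 𝕜) ∈
        LinearMap.ker (LinearMap.proj (R := 𝕜) (φ := fun _ : Fin N => 𝕜) j) :=
          h ▸ Submodule.mem_top
      simp at h1
  obtain ⟨a, ha, haTa⟩ := hdense.inter_nhds_nonempty hTa
  have ha' : ∀ j, a j ≠ 0 := fun j h => ha j (by simpa using h)
  have hAa : A a ≠ 0 := (hTab (Set.mk_mem_prod haTa (mem_of_mem_nhds hTb))).2.2.1
  obtain ⟨b, ⟨hpair, hcop⟩, hbTb⟩ := (dense_generic hl ha' hAa).inter_nhds_nonempty hTb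
  obtain ⟨hxT, ⟨α, ⟨hαS, hα0⟩, hα⟩, -, hEx⟩ := hTab (Set.mk_mem_prod haTa hbTb)
  have hα0' : α ≠ 0 := hα0
  set t := (4 * α * E (a, b))⁻¹ with ht
  have ht0 : t ≠ 0 := inv_ne_zero (mul_ne_zero (mul_ne_zero (by norm_num) hα0') hEx)
  have htα : t * α * E (a, b) = 1 / 4 := by rw [ht]; field_simp
  have hscale : ∀ s : 𝕜, ∀ c : Fin N → 𝕜, ∑ j, lam j * (s * c j) ^ 2 = s ^ 2 * A c := by
    intro s c
    simp only [A, Finset.mul_sum]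
    exact Finset.sum_congr rfl fun j _ => by ring
  refine ⟨Θ (α, a, b), hST (Set.mk_mem_prod hαS hxT), mem_M_iff.2 ?_, ?_⟩
  · simp only [Θ, ofDiffSum_sub, ofDiffSum_add, ← ht, hscale]
    refine ⟨?_, ?_, mul_ne_zero (pow_ne_zero 2 hα0') hAa⟩
    · rw [← htα]
      simp only [E, Finset.mul_sum]
      exact Finset.sum_congr rfl fun j _ => by ring
    · have hα4 : α ^ 4 = -A b / (16 * E (a, b) ^ 2 * A a) := hα
      rw [eq_div_iff (mul_ne_zero (mul_ne_zero (by norm_num) (pow_ne_zero 2 hEx)) hAa)] at hα4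
      rw [ht]
      field_simp
      linear_combination hα4
  · have hunit : ∀ {s : 𝕜}, s ≠ 0 → IsUnit (C s) := fun hs => isUnit_C.2 (isUnit_iff_ne_zero.2 hs)
    constructor
    · simp only [Θ, ofDiffSum_sub, hscale]
      exact mul_ne_zero (pow_ne_zero 2 hα0') hAa
    · intro j k
      simp only [Θ, ofDiffSum_sub, ofDiffSum_add, ← ht]
      have := mul_ne_zero (mul_ne_zero hα0' ht0) (hpair j k)
      intro h
      exact this (by linear_combination h)
    · simp only [Θ, ofDiffSum_sub, ofDiffSum_add, ← ht]
      have e1 : (fun j => lam j * (α * a j) ^ 2) = fun j => α ^ 2 * (lam j * a j ^ 2) := by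
        funext j; ring
      have e2 : (fun j => lam j ^ 2 * (α * a j * (t * b j))) =
          fun j => α * t * (lam j ^ 2 * (a j * b j)) := by
        funext j; ring
      rw [e1, e2, numer_mul_left, numer_mul_left]
      exact (isCoprime_mul_unit_left_left (hunit (pow_ne_zero 2 hα0')) _ _).2
        ((isCoprime_mul_unit_left_right (hunit (mul_ne_zero hα0' ht0)) _ _).2 hcop)

end

/-! ### Independence of the integrals on an open dense subset -/

section
variable {𝕜 : Type*} [NontriviallyNormedField 𝕜] [CharZero 𝕜] {N : ℕ}

/-- A covector which vanishes on `T_z M` and on the Hamiltonian field of `F` is a multiple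
of `dF`. -/
theorem exists_eq_mul_fderiv_conF {lam : Fin N → 𝕜} {z : Phase 𝕜 N} (hz : z ∈ M lam)
    (ρ : Phase 𝕜 N →L[𝕜] 𝕜) (hF : ρ (hamField conF z) = 0) (hT : ∀ w ∈ tangentM lam z, ρ w = 0) :
    ∃ κ : 𝕜, ∀ w, ρ w = κ * fderiv 𝕜 conF z w := by
  refine ⟨ρ (hamField (conG lam) z) / (4 * (Lam lam 1 z.1 ⬝ᵥ z.2)), fun w => ?_⟩
  obtain ⟨α, hα⟩ := exists_projection hz w
  have h := hT _ hα
  rw [map_sub, map_add, map_smul, map_smul, hF, smul_zero, add_zero, smul_eq_mul] at h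
  linear_combination h

theorem sum_smul_fderiv_hamField_conF {lam : Fin N → 𝕜} (hl : ∀ j, lam j ≠ 0) (z : Phase 𝕜 N)
    (c : Fin (N - 1) → 𝕜) :
    (∑ i, c i • fderiv 𝕜 (integrals lam i) z) (hamField conF z) = 0 := by
  rw [sum_apply]
  refine Finset.sum_eq_zero fun i _ => ?_
  have h := poisson_conF_Fm hl (i : ℕ) z
  rw [smul_apply, fderiv_hamField, poisson_swap, integrals]
  push_cast at h
  rw [h, neg_zero, smul_zero]

omit [CharZero 𝕜] in
theorem sum_smul_domRestrict_apply (lam : Fin N → 𝕜) (z : Phase 𝕜 N) (c : Fin (N - 1) → 𝕜)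
    (w : tangentM lam z) :
    (∑ i, c i • (fderiv 𝕜 (integrals lam i) z).toLinearMap.domRestrict (tangentM lam z)) w =
      (∑ i, c i • fderiv 𝕜 (integrals lam i) z) w := by
  simp

/-- At a generic point of `M` the map from variations of `b = q + p` to the variations of `F` and of
the `N - 1` integrals is injective, hence bijective. -/
theorem linearIndependent_of_isGeneric {lam : Fin N → 𝕜} (hinj : Function.Injective lam)
    (hl : ∀ j, lam j ≠ 0) {z : Phase 𝕜 N} (hz : z ∈ M lam) (hg : IsGeneric lam z) :
    LinearIndependent 𝕜 fun i =>
      (fderiv 𝕜 (integrals lam i) z).toLinearMap.domRestrict (tangentM lam z) := by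
  rw [Fintype.linearIndependent_iff]
  intro c hc i₀
  obtain ⟨κ, hκ⟩ := exists_eq_mul_fderiv_conF hz (∑ i, c i • fderiv 𝕜 (integrals lam i) z)
    (sum_smul_fderiv_hamField_conF hl z c) fun w hw => by
      rw [← sum_smul_domRestrict_apply lam z c ⟨w, hw⟩, hc, LinearMap.zero_apply]
  let Ψ : (Fin N → 𝕜) →ₗ[𝕜] (Fin (N - 1) → 𝕜) × 𝕜 :=
    { toFun := fun β => (fun i => ∑ j, PowerSeries.coeff ((i : ℕ) + 1) (gradB lam z j) * β j,
        ∑ j, β j * (z.1 j - z.2 j))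
      map_add' := fun β γ => by
        ext <;> simp [mul_add, add_mul, Finset.sum_add_distrib]
      map_smul' := fun t β => by
        ext <;> simp [Finset.mul_sum, mul_left_comm, mul_assoc] }
  have hΨ : Function.Injective Ψ := by
    rw [← LinearMap.ker_eq_bot, LinearMap.ker_eq_bot']
    intro β hβ
    obtain ⟨h1, h2⟩ := Prod.mk.inj hβ
    exact hg.eq_zero hinj hl hz.1 h2 fun n hn => congrFun h1 ⟨n, hn⟩
  have hrank : Module.finrank 𝕜 (Fin N → 𝕜) = Module.finrank 𝕜 ((Fin (N - 1) → 𝕜) × 𝕜) := by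
    have := i₀.2
    simp
    omega
  obtain ⟨β, hβ⟩ :=
    (LinearMap.injective_iff_surjective_of_finrank_eq_finrank hrank).1 hΨ (Pi.single i₀ 1, 0)
  obtain ⟨h1, h2⟩ := Prod.mk.inj hβ
  have hF : fderiv 𝕜 conF z (β, β) = 0 := by
    rw [fderiv_conF, ← mul_sub, ← sub_dotProduct, dotProduct_comm]
    simpa [dotProduct] using h2
  have hint : ∀ i, fderiv 𝕜 (integrals lam i) z (β, β) = -(Pi.single i₀ 1 : Fin (N - 1) → 𝕜) i := by
    intro i
    have h := fderiv_Fm hl (i : ℕ) z (β, β)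
    push_cast at h
    rw [integrals, h, ← h1, Finset.mul_sum, ← Finset.sum_neg_distrib]
    exact Finset.sum_congr rfl fun j _ => by ring
  have h := hκ (β, β)
  rw [hF, mul_zero, sum_apply] at h
  simpa [hint, Pi.single_apply] using h

theorem linearIndependent_domRestrict_iff {lam : Fin N → 𝕜} (hl : ∀ j, lam j ≠ 0) {z : Phase 𝕜 N}
    (hz : z ∈ M lam) :
    (LinearIndependent 𝕜 fun i =>
      (fderiv 𝕜 (integrals lam i) z).toLinearMap.domRestrict (tangentM lam z)) ↔
    LinearIndependent 𝕜 fun o : Option (Fin (N - 1)) =>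
      o.elim (fderiv 𝕜 conF z) fun i => fderiv 𝕜 (integrals lam i) z := by
  rw [Fintype.linearIndependent_iff, Fintype.linearIndependent_iff]
  constructor
  · intro h c hc
    rw [Fintype.sum_option] at hc
    simp only [Option.elim] at hc
    have hsome : ∀ i, c (some i) = 0 := by
      refine h (fun i => c (some i)) ?_
      ext ⟨w, hw⟩
      rw [sum_smul_domRestrict_apply, LinearMap.zero_apply]
      have h0 := congrArg (fun L : Phase 𝕜 N →L[𝕜] 𝕜 => L w) hc
      simpa only [add_apply, smul_apply, (mem_tangentM.1 hw).1, smul_zero, zero_add,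
        zero_apply] using h0
    have hnone : c none = 0 := by
      have h0 := congrArg (fun L : Phase 𝕜 N →L[𝕜] 𝕜 => L (hamField (conG lam) z)) hc
      simp only [add_apply, sum_apply, smul_apply, fderiv_hamField, poisson_conF_conG, zero_apply,
        smul_eq_mul, hsome, zero_mul, Finset.sum_const_zero, add_zero] at h0
      exact (mul_eq_zero.1 h0).resolve_right (mul_ne_zero (by norm_num) hz.2.2)
    rintro (_ | i)
    exacts [hnone, hsome i]
  · intro h c hc i
    obtain ⟨κ, hκ⟩ := exists_eq_mul_fderiv_conF hz (∑ i, c i • fderiv 𝕜 (integrals lam i) z)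
      (sum_smul_fderiv_hamField_conF hl z c) fun w hw => by
        rw [← sum_smul_domRestrict_apply lam z c ⟨w, hw⟩, hc, LinearMap.zero_apply]
    refine h (fun o => o.elim (-κ) c) ?_ (some i)
    rw [Fintype.sum_option]
    simp only [Option.elim]
    refine ContinuousLinearMap.ext fun w => ?_
    rw [add_apply, hκ, smul_apply, smul_eq_mul, zero_apply]
    ring

variable [CompleteSpace 𝕜]

theorem isOpen_linearIndependent {lam : Fin N → 𝕜} (hl : ∀ j, lam j ≠ 0) :
    IsOpen {z : M lam | LinearIndependent 𝕜 fun i =>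
      (fderiv 𝕜 (integrals lam i) (z : Phase 𝕜 N)).toLinearMap.domRestrict
        (tangentM lam (z : Phase 𝕜 N))} := by
  simp only [fun z : M lam => linearIndependent_domRestrict_iff hl z.2]
  refine isOpen_setOfPred_linearIndependent.preimage (f := fun z : M lam =>
    fun o : Option (Fin (N - 1)) => o.elim (fderiv 𝕜 conF (z : Phase 𝕜 N))
      fun i => fderiv 𝕜 (integrals lam i) (z : Phase 𝕜 N)) ?_
  refine continuous_pi ?_
  rintro (_ | i)
  · exact (contDiff_conF.continuous_fderiv (by simp)).comp continuous_subtype_val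
  · exact ((contDiff_Fm lam _).continuous_fderiv (by simp)).comp continuous_subtype_val

theorem dense_linearIndependent {lam : Fin N → 𝕜} (hinj : Function.Injective lam)
    (hl : ∀ j, lam j ≠ 0) :
    Dense {z : M lam | LinearIndependent 𝕜 fun i =>
      (fderiv 𝕜 (integrals lam i) (z : Phase 𝕜 N)).toLinearMap.domRestrict
        (tangentM lam (z : Phase 𝕜 N))} := by
  intro z
  rw [mem_closure_iff_nhds]
  intro t ht
  obtain ⟨V, hV, hVt⟩ := mem_nhds_subtype _ _ _ |>.1 ht
  obtain ⟨z', hz'V, hz', hg⟩ := exists_isGeneric_mem hl z.2 hV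
  exact ⟨⟨z', hz'⟩, hVt hz'V, linearIndependent_of_isGeneric hinj hl hz' hg⟩

/-! ### Liouville integrability -/

theorem isLiouvilleIntegrable_of {lam : Fin N → 𝕜} (hinj : Function.Injective lam)
    (hl : ∀ j, lam j ≠ 0) {V : Phase 𝕜 N → Phase 𝕜 N} {h : Phase 𝕜 N → 𝕜} (hsm : ContDiff 𝕜 ∞ h)
    (hV : ∀ z ∈ M lam, V z = diracField lam h z)
    (hh : ∀ m < 0, ∀ z ∈ M lam, dirac lam h (Fm lam m) z = 0) :
    IsLiouvilleIntegrable lam V h (integrals lam) where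
  smooth_h _ _ := hsm.contDiffAt
  smooth_f _ _ _ := (contDiff_Fm lam _).contDiffAt
  tangent z hz := by rw [hV z hz]; exact diracField_mem_tangentM hz h
  hamiltonian := hV
  conserved i z hz := hh _ (by omega) z hz
  involution i k z _ := dirac_Fm_Fm hl (by omega) (by omega) z
  isOpen_independent := isOpen_linearIndependent hl
  dense_independent := dense_linearIndependent hinj hl

theorem isLiouvilleIntegrable_Fm {lam : Fin N → 𝕜} (hinj : Function.Injective lam)
    (hl : ∀ j, lam j ≠ 0) {m : ℤ} (hm : m < 0) :
    IsLiouvilleIntegrable lam (diracField lam (Fm lam m)) (Fm lam m) (integrals lam) :=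
  isLiouvilleIntegrable_of hinj hl (contDiff_Fm lam m) (fun _ _ => rfl)
    fun _ hn z _ => dirac_Fm_Fm hl hm hn z

theorem isLiouvilleIntegrable_realH {lam : Fin N → 𝕜} (hinj : Function.Injective lam)
    (hl : ∀ j, lam j ≠ 0) :
    IsLiouvilleIntegrable lam (realField lam) (realH lam) (integrals lam) :=
  isLiouvilleIntegrable_of hinj hl (contDiff_realH lam) (fun _ hz => realField_eq_diracField hz)
    fun _ hm _ hz => dirac_realH_Fm hl hm hz

end

/-! ### The complex Hamiltonian -/

section
variable {N : ℕ}

theorem dq_H (lam : Fin N → ℂ) (z : Phase ℂ N) :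
    dq (H lam) z = -Complex.I • dq (realH lam) z := by
  have h : fderiv ℂ (H lam) z = -Complex.I • fderiv ℂ (realH lam) z :=
    fderiv_const_mul ((contDiff_realH lam).differentiable (by simp) z) _
  ext j
  simp [dq, h]

theorem dp_H (lam : Fin N → ℂ) (z : Phase ℂ N) :
    dp (H lam) z = -Complex.I • dp (realH lam) z := by
  have h : fderiv ℂ (H lam) z = -Complex.I • fderiv ℂ (realH lam) z :=
    fderiv_const_mul ((contDiff_realH lam).differentiable (by simp) z) _
  ext j
  simp [dp, h]

theorem poisson_H_left (lam : Fin N → ℂ) (f : Phase ℂ N → ℂ) (z : Phase ℂ N) :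
    poisson (H lam) f z = -Complex.I * poisson (realH lam) f z := by
  rw [poisson, poisson, dq_H, dp_H, smul_dotProduct, smul_dotProduct, smul_eq_mul, smul_eq_mul,
    mul_sub]

theorem dirac_H_left (lam : Fin N → ℂ) (f : Phase ℂ N → ℂ) (z : Phase ℂ N) :
    dirac lam (H lam) f z = -Complex.I * dirac lam (realH lam) f z := by
  simp only [dirac, poisson_H_left]; ring

theorem diracField_H (lam : Fin N → ℂ) (z : Phase ℂ N) :
    diracField lam (H lam) z = -Complex.I • diracField lam (realH lam) z := by
  have h : hamField (H lam) z = -Complex.I • hamField (realH lam) z := by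
    rw [hamField, dp_H, dq_H, ← smul_neg]; rfl
  rw [diracField_eq, diracField_eq, h, poisson_swap _ (H lam), poisson_swap _ (H lam),
    poisson_H_left, poisson_H_left, poisson_swap _ (realH lam), poisson_swap _ (realH lam)]
  module

theorem mkdvField_eq (lam : Fin N → ℂ) (z : Phase ℂ N) :
    mkdvField lam z = -Complex.I • realField lam z := by
  ext j
  · simp [mkdvField, realField]; ring
  · simp [mkdvField, realField]; ring

theorem realField_toComplex (lam : Fin N → ℝ) (z : Phase ℝ N) :
    realField (fun j => (lam j : ℂ)) (toComplex z) = toComplex (realField lam z) := by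
  ext j <;> simp [realField, toComplex, potential, Lam, dotProduct]

theorem dirac_H_Fm {lam : Fin N → ℂ} (hl : ∀ j, lam j ≠ 0) {m : ℤ} (hm : m < 0) {z : Phase ℂ N}
    (hz : z ∈ M lam) : dirac lam (H lam) (Fm lam m) z = 0 := by
  rw [dirac_H_left, dirac_realH_Fm hl hm hz, mul_zero]

theorem isLiouvilleIntegrable_H {lam : Fin N → ℂ} (hinj : Function.Injective lam)
    (hl : ∀ j, lam j ≠ 0) :
    IsLiouvilleIntegrable lam (mkdvField lam) (H lam) (integrals lam) :=
  isLiouvilleIntegrable_of hinj hl (contDiff_const.mul (contDiff_realH lam))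
    (fun z hz => by rw [mkdvField_eq, diracField_H, realField_eq_diracField hz])
    fun _ hm _ hz => dirac_H_Fm hl hm hz

end

end RestrictedMKdV

open RestrictedMKdV
theorem theorem4 (N : ℕ) :
    (∀ lam : Fin N → ℂ, Function.Injective lam → (∀ j, lam j ≠ 0) →
      IsSymplecticM lam ∧
      (∀ m n : ℤ, m < 0 → n < 0 → ∀ z ∈ M lam,
        dirac lam (Fm lam m) (Fm lam n) z = 0 ∧ dirac lam (H lam) (Fm lam m) z = 0) ∧
      IsLiouvilleIntegrable lam (mkdvField lam) (H lam) (integrals lam) ∧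
      ∀ m : ℤ, m < 0 →
        IsLiouvilleIntegrable lam (diracField lam (Fm lam m)) (Fm lam m) (integrals lam)) ∧
    (∀ lam : Fin N → ℝ, Function.Injective lam → (∀ j, lam j ≠ 0) →
      IsSymplecticM lam ∧
      (∀ m n : ℤ, m < 0 → n < 0 → ∀ z ∈ M lam,
        dirac lam (Fm lam m) (Fm lam n) z = 0 ∧ dirac lam (realH lam) (Fm lam m) z = 0) ∧
      (∀ z : Phase ℝ N, mkdvField (fun j => (lam j : ℂ)) (toComplex z) =
        -Complex.I • toComplex (realField lam z)) ∧
      IsLiouvilleIntegrable lam (realField lam) (realH lam) (integrals lam) ∧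
      ∀ m : ℤ, m < 0 →
        IsLiouvilleIntegrable lam (diracField lam (Fm lam m)) (Fm lam m) (integrals lam)) := by

  refine ⟨fun lam hinj hl => ⟨isSymplecticM lam, fun m n hm hn z hz =>
      ⟨dirac_Fm_Fm hl hm hn z, dirac_H_Fm hl hm hz⟩, isLiouvilleIntegrable_H hinj hl,
      fun m hm => isLiouvilleIntegrable_Fm hinj hl hm⟩,
    fun lam hinj hl => ⟨isSymplecticM lam, fun m n hm hn z hz =>
      ⟨dirac_Fm_Fm hl hm hn z, dirac_realH_Fm hl hm hz⟩, fun z => ?_,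
      isLiouvilleIntegrable_realH hinj hl, fun m hm => isLiouvilleIntegrable_Fm hinj hl hm⟩⟩
  rw [mkdvField_eq, realField_toComplex]
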